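/- Let $V$ be a countably infinite set and let $(V,b,c,m)$ be a connected, locally finite weighted graph. That is, $b:V\times V\to[0,\infty)$ is symmetric with zero diagonal, $c:V\to[0,\infty)$, $m:V\to(0,\infty)$, every $x\in V$ has only finitely many neighbours $y\sim x$ (meaning $b(x,y)>0$), and any two vertices are joined by a path of neighbours. Let $d$ be the combinatorial graph distance and put $$\widetilde L f(x)=\frac1{m(x)}\sum_{y}b(x,y)\,(f(x)-f(y))+\frac{c(x)}{m(x)}f(x)\qquad (f:V\to\mathbb R).$$ Let $\langle f,g\rangle=\sum_x f(x)g(x)m(x)$ be the inner product of the real Hilbert space $\ell^2(V,m)$, let $$Q(f,g)=\tfrac12\sum_{x,y}b(x,y)(f(x)-f(y))(g(x)-g(y))+\sum_x c(x)f(x)g(x),$$ and let $D(Q)\subseteq\ell^2(V,m)$ be the closure of the finitely supported functions with respect to $\langle\cdot,\cdot\rangle+Q(\cdot,\cdot)$. Let $L$ be the Laplacian of the graph, i.e. the positive self-adjoint operator in $\ell^2(V,m)$ associated with $Q$: $u\in D(L)$ and $Lu=h$ if and only if $u\in D(Q)$, $h\in\ell^2(V,m)$ and $Q(u,g)=\langle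 h,g\rangle$ for all $g\in D(Q)$. The graph is called weakly spherically symmetric if there is a vertex $x_0$ such that the functions $$\kappa_\pm(x)=\frac1{m(x)}\sum_{y:\,d(x_0,y)=d(x_0,x)\pm1}b(x,y)\qquad\text{and}\qquad q(x)=\frac{c(x)}{m(x)}$$ depend only on $d(x_0,x)$. It is called stochastically incomplete at infinity if bounded solutions of its heat equation are not unique, i.e. if there is a bounded function $u:V\times[0,\infty)\to\mathbb R$, not identically zero, such that for every $x\in V$ the function $u(x,\cdot)$ is continuous on $[0,\infty)$ and differentiable on $(0,\infty)$, with $\frac{d}{dt}u(x,t)=-\widetilde L u(\cdot,t)(x)$ for $t>0$ and $u(x,0)=0$. **Corollary.** If $(V,b,c,m)$ is weakly spherically symmetric and stochastically incomplete at infinity, then $$\lambda_0(L):=\inf\sigma(L)>0\qquad\text{and}\qquad \sigma(L)=\sigma_{\mathrm{disc}}(L),$$ where $\sigma_{\mathrm{disc}}(L)$ is the set of isolated points of the spectrum $\sigma(L)$ that are eigenvalues of finite multiplicity. -/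

import Mathlib

open Filter Topology MeasureTheory
open scoped ENNReal

noncomputable section

/-! ### Weighted graphs -/

/-- A connected, locally finite weighted graph `(V, b, c, m)`: symmetric edge weights `b ≥ 0` with
zero diagonal, a killing term `c ≥ 0` and a measure `m > 0` of full support. The neighbours of `x`
are the `y` with `b x y > 0`. -/
structure WeightedGraph (V : Type*) where
  /-- edge weights -/
  b : V → V → ℝ
  /-- potential (killing term) -/
  c : V → ℝ
  /-- vertex measure -/
  m : V → ℝ
  b_nonneg : ∀ x y, 0 ≤ b x y
  b_symm : ∀ x y, b x y = b y x
  b_diag : ∀ x, b x x = 0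
  c_nonneg : ∀ x, 0 ≤ c x
  m_pos : ∀ x, 0 < m x
  locallyFinite : ∀ x, {y | 0 < b x y}.Finite
  connected : ∀ x y, Relation.ReflTransGen (fun u v => 0 < b u v) x y

namespace WeightedGraph

variable {V : Type*} (G : WeightedGraph V)

/-- The underlying combinatorial graph, `x ∼ y` iff `b x y > 0`. -/
def toSimpleGraph : SimpleGraph V where
  Adj x y := 0 < G.b x y
  symm := ⟨fun x y h => by rw [G.b_symm y x]; exact h⟩
  loopless := ⟨fun x h => by rw [G.b_diag x] at h; exact lt_irrefl _ h⟩

/-- The combinatorial distance: the number of edges in a shortest path. -/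
def dist (x y : V) : ℕ := G.toSimpleGraph.dist x y

/-- Outer curvature with respect to `x₀`: `κ₊(x) = (1/m(x)) ∑_{y ∈ S_{r+1}} b(x,y)`, `x ∈ S_r`. -/
def outerCurvature (x₀ x : V) : ℝ :=
  1 / G.m x * ∑ᶠ y ∈ {y | G.dist x₀ y = G.dist x₀ x + 1}, G.b x y

/-- Inner curvature with respect to `x₀`: `κ₋(x) = (1/m(x)) ∑_{y ∈ S_{r-1}} b(x,y)`, `x ∈ S_r`
(the empty sum for `r = 0`). -/
def innerCurvature (x₀ x : V) : ℝ :=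
  1 / G.m x * ∑ᶠ y ∈ {y | G.dist x₀ y + 1 = G.dist x₀ x}, G.b x y

/-- The normalized potential `q = c / m`. -/
def normalizedPotential (x : V) : ℝ := G.c x / G.m x

/-- `f` depends only on the distance to `x₀`. -/
def SphericallySymmetric (x₀ : V) (f : V → ℝ) : Prop :=
  ∃ g : ℕ → ℝ, ∀ x, f x = g (G.dist x₀ x)

/-- Weak spherical symmetry: `κ₊`, `κ₋` and `q` are spherically symmetric about some vertex. -/
def WeaklySphericallySymmetric : Prop :=
  ∃ x₀ : V, G.SphericallySymmetric x₀ (G.outerCurvature x₀) ∧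
    G.SphericallySymmetric x₀ (G.innerCurvature x₀) ∧
    G.SphericallySymmetric x₀ G.normalizedPotential

/-! ### The heat equation and stochastic incompleteness at infinity -/

/-- The formal Laplacian `L̃ f(x) = (1/m(x)) ∑_y b(x,y) (f(x) - f(y)) + (c(x)/m(x)) f(x)`
(a finite sum, by local finiteness). -/
def formalLaplacian (f : V → ℝ) (x : V) : ℝ :=
  1 / G.m x * ∑ᶠ y, G.b x y * (f x - f y) + G.c x / G.m x * f x

/-- `u` solves `(L̃ + d/dt) u = 0` on `V × (0, ∞)` with `u(·, 0) = u₀`. -/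
structure IsHeatSolution (u₀ : V → ℝ) (u : V → ℝ → ℝ) : Prop where
  continuousOn : ∀ x, ContinuousOn (u x) (Set.Ici 0)
  hasDerivAt : ∀ x t, 0 < t → HasDerivAt (u x) (-G.formalLaplacian (fun y => u y t) x) t
  initial : ∀ x, u x 0 = u₀ x

/-- Stochastic incompleteness at infinity: bounded solutions of the heat equation are not unique,
i.e. there is a non-trivial bounded solution with initial condition `0`. -/
def StochasticallyIncompleteAtInfinity : Prop :=
  ∃ u : V → ℝ → ℝ, G.IsHeatSolution (fun _ => 0) u ∧
    (∃ C, ∀ x t, 0 ≤ t → |u x t| ≤ C) ∧ ∃ x t, 0 ≤ t ∧ u x t ≠ 0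

/-! ### The Dirichlet form -/

/-- The quadratic form `½ ∑_{x,y} b(x,y) (f(x) - f(y))² + ∑_x c(x) f(x)²` with values in `[0, ∞]`. -/
def energy (f : V → ℝ) : ℝ≥0∞ :=
  2⁻¹ * ∑' p : V × V, ENNReal.ofReal (G.b p.1 p.2 * (f p.1 - f p.2) ^ 2) +
    ∑' x, ENNReal.ofReal (G.c x * f x ^ 2)

/-- The bilinear form
`Q(f, g) = ½ ∑_{x,y} b(x,y) (f(x) - f(y)) (g(x) - g(y)) + ∑_x c(x) f(x) g(x)`; both sums converge
absolutely when `f` and `g` have finite energy. -/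
def form (f g : V → ℝ) : ℝ :=
  1 / 2 * ∑' p : V × V, G.b p.1 p.2 * (f p.1 - f p.2) * (g p.1 - g p.2) +
    ∑' x, G.c x * f x * g x

variable {G}

theorem energy_add_le (f g : V → ℝ) :
    G.energy (f + g) ≤ 2 * G.energy f + 2 * G.energy g := by
  have key : ∀ k x y : ℝ, 0 ≤ k → ENNReal.ofReal (k * (x + y) ^ 2) ≤
      2 * ENNReal.ofReal (k * x ^ 2) + 2 * ENNReal.ofReal (k * y ^ 2) := by
    intro k x y hk
    rw [← ENNReal.ofReal_ofNat 2, ← ENNReal.ofReal_mul (by norm_num),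
      ← ENNReal.ofReal_mul (by norm_num), ← ENNReal.ofReal_add (by positivity) (by positivity)]
    apply ENNReal.ofReal_le_ofReal
    nlinarith [mul_nonneg hk (sq_nonneg (x - y))]
  have h1 : ∑' p : V × V, ENNReal.ofReal (G.b p.1 p.2 * ((f + g) p.1 - (f + g) p.2) ^ 2) ≤
      2 * ∑' p : V × V, ENNReal.ofReal (G.b p.1 p.2 * (f p.1 - f p.2) ^ 2) +
      2 * ∑' p : V × V, ENNReal.ofReal (G.b p.1 p.2 * (g p.1 - g p.2) ^ 2) := by
    rw [← ENNReal.tsum_mul_left, ← ENNReal.tsum_mul_left, ← ENNReal.tsum_add]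
    refine ENNReal.tsum_le_tsum fun p => ?_
    have := key (G.b p.1 p.2) (f p.1 - f p.2) (g p.1 - g p.2) (G.b_nonneg _ _)
    convert this using 4
    simp only [Pi.add_apply]; ring
  have h2 : ∑' x, ENNReal.ofReal (G.c x * (f + g) x ^ 2) ≤
      2 * ∑' x, ENNReal.ofReal (G.c x * f x ^ 2) +
      2 * ∑' x, ENNReal.ofReal (G.c x * g x ^ 2) := by
    rw [← ENNReal.tsum_mul_left, ← ENNReal.tsum_mul_left, ← ENNReal.tsum_add]
    exact ENNReal.tsum_le_tsum fun x => key _ _ _ (G.c_nonneg _)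
  unfold energy
  refine (add_le_add (mul_le_mul_right h1 _) h2).trans (le_of_eq ?_)
  ring

theorem energy_smul (a : ℝ) (f : V → ℝ) :
    G.energy (a • f) = ENNReal.ofReal (a ^ 2) * G.energy f := by
  have h1 : ∑' p : V × V, ENNReal.ofReal (G.b p.1 p.2 * ((a • f) p.1 - (a • f) p.2) ^ 2) =
      ENNReal.ofReal (a ^ 2) *
        ∑' p : V × V, ENNReal.ofReal (G.b p.1 p.2 * (f p.1 - f p.2) ^ 2) := by
    rw [← ENNReal.tsum_mul_left]
    refine tsum_congr fun p => ?_
    rw [← ENNReal.ofReal_mul (sq_nonneg a)]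
    congr 1; simp only [Pi.smul_apply, smul_eq_mul]; ring
  have h2 : ∑' x, ENNReal.ofReal (G.c x * (a • f) x ^ 2) =
      ENNReal.ofReal (a ^ 2) * ∑' x, ENNReal.ofReal (G.c x * f x ^ 2) := by
    rw [← ENNReal.tsum_mul_left]
    refine tsum_congr fun x => ?_
    rw [← ENNReal.ofReal_mul (sq_nonneg a)]
    congr 1; simp only [Pi.smul_apply, smul_eq_mul]; ring
  unfold energy
  rw [h1, h2]; ring

theorem summable_edges_of_energy {f : V → ℝ} (hf : G.energy f ≠ ∞) :
    Summable fun p : V × V => G.b p.1 p.2 * (f p.1 - f p.2) ^ 2 := by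
  have h : ∑' p : V × V, ENNReal.ofReal (G.b p.1 p.2 * (f p.1 - f p.2) ^ 2) ≠ ∞ := by
    intro h; apply hf; simp [energy, h]
  refine (ENNReal.summable_toReal h).congr fun p => ?_
  rw [ENNReal.toReal_ofReal (mul_nonneg (G.b_nonneg _ _) (sq_nonneg _))]

theorem summable_vertices_of_energy {f : V → ℝ} (hf : G.energy f ≠ ∞) :
    Summable fun x => G.c x * f x ^ 2 := by
  have h : ∑' x, ENNReal.ofReal (G.c x * f x ^ 2) ≠ ∞ := by
    intro h; apply hf; simp [energy, h]
  refine (ENNReal.summable_toReal h).congr fun p => ?_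
  rw [ENNReal.toReal_ofReal (mul_nonneg (G.c_nonneg _) (sq_nonneg _))]

theorem summable_mul_of_sq {ι : Type*} {k f g : ι → ℝ} (hk : ∀ i, 0 ≤ k i)
    (hf : Summable fun i => k i * f i ^ 2) (hg : Summable fun i => k i * g i ^ 2) :
    Summable fun i => k i * f i * g i := by
  refine Summable.of_norm_bounded (hf.add hg) fun i => ?_
  rw [Real.norm_eq_abs, abs_le]
  have := mul_nonneg (hk i) (sq_nonneg (f i + g i))
  have := mul_nonneg (hk i) (sq_nonneg (f i - g i))
  have := mul_nonneg (hk i) (sq_nonneg (f i))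
  have := mul_nonneg (hk i) (sq_nonneg (g i))
  constructor <;> nlinarith

theorem form_add_left {f f' g : V → ℝ} (hf : G.energy f ≠ ∞) (hf' : G.energy f' ≠ ∞)
    (hg : G.energy g ≠ ∞) : G.form (f + f') g = G.form f g + G.form f' g := by
  have e := fun {f : V → ℝ} (hf : G.energy f ≠ ∞) => summable_mul_of_sq
    (k := fun p : V × V => G.b p.1 p.2) (f := fun p => f p.1 - f p.2)
    (g := fun p => g p.1 - g p.2) (fun p => G.b_nonneg _ _)
    (summable_edges_of_energy hf) (summable_edges_of_energy hg)
  have v := fun {f : V → ℝ} (hf : G.energy f ≠ ∞) => summable_mul_of_sq (k := G.c) (f := f)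
    (g := g) G.c_nonneg (summable_vertices_of_energy hf) (summable_vertices_of_energy hg)
  have h1 : ∑' p : V × V, G.b p.1 p.2 * ((f + f') p.1 - (f + f') p.2) * (g p.1 - g p.2) =
      ∑' p : V × V, G.b p.1 p.2 * (f p.1 - f p.2) * (g p.1 - g p.2) +
      ∑' p : V × V, G.b p.1 p.2 * (f' p.1 - f' p.2) * (g p.1 - g p.2) := by
    rw [← (e hf).tsum_add (e hf')]
    exact tsum_congr fun p => by simp only [Pi.add_apply]; ring
  have h2 : ∑' x, G.c x * (f + f') x * g x =
      ∑' x, G.c x * f x * g x + ∑' x, G.c x * f' x * g x := by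
    rw [← (v hf).tsum_add (v hf')]
    exact tsum_congr fun p => by simp only [Pi.add_apply]; ring
  unfold form
  rw [h1, h2]; ring

theorem form_smul_left (a : ℝ) (f g : V → ℝ) : G.form (a • f) g = a * G.form f g := by
  have h1 : ∑' p : V × V, G.b p.1 p.2 * ((a • f) p.1 - (a • f) p.2) * (g p.1 - g p.2) =
      a * ∑' p : V × V, G.b p.1 p.2 * (f p.1 - f p.2) * (g p.1 - g p.2) := by
    rw [← tsum_mul_left]
    exact tsum_congr fun p => by simp only [Pi.smul_apply, smul_eq_mul]; ring
  have h2 : ∑' x, G.c x * (a • f) x * g x = a * ∑' x, G.c x * f x * g x := by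
    rw [← tsum_mul_left]
    exact tsum_congr fun x => by simp only [Pi.smul_apply, smul_eq_mul]; ring
  unfold form
  rw [h1, h2]; ring

theorem energy_ne_top_of_finite_support {f : V → ℝ} (hf : (Function.support f).Finite) :
    G.energy f ≠ ∞ := by
  have hfin : ∀ {ι : Type _} (k : ι → ℝ), (Function.support k).Finite →
      ∑' i, ENNReal.ofReal (k i) ≠ ∞ := by
    intro ι k hk
    rw [tsum_eq_sum (s := hk.toFinset) (fun i hi => by simp_all)]
    exact (ENNReal.sum_lt_top.2 fun i _ => ENNReal.ofReal_lt_top).ne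
  unfold energy
  refine ENNReal.add_ne_top.2 ⟨ENNReal.mul_ne_top (by simp) (hfin _ ?_), hfin _ ?_⟩
  · have h1 : (⋃ x ∈ Function.support f, ({x} ×ˢ {y | 0 < G.b x y} : Set (V × V))).Finite :=
      hf.biUnion fun x _ => (Set.finite_singleton x).prod (G.locallyFinite x)
    refine (h1.union (h1.image Prod.swap)).subset ?_
    rintro ⟨x, y⟩ hxy
    simp only [Function.mem_support, ne_eq, mul_eq_zero, not_or, pow_eq_zero_iff two_ne_zero,
      sub_eq_zero] at hxy
    have hb : 0 < G.b x y := lt_of_le_of_ne (G.b_nonneg x y) (Ne.symm hxy.1)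
    by_cases hx : f x = 0
    · have hy : f y ≠ 0 := fun h => hxy.2 (hx.trans h.symm)
      exact Or.inr ⟨(y, x), Set.mem_biUnion hy ⟨rfl, (G.b_symm x y ▸ hb : 0 < G.b y x)⟩, rfl⟩
    · exact Or.inl (Set.mem_biUnion hx ⟨rfl, hb⟩)
  · exact hf.subset fun x hx h => hx (by simp [h])

/-! ### The Hilbert space `ℓ²(V, m)` and the Laplacian -/

variable [MeasurableSpace V]

variable (G) in
/-- The measure on `V` with `μ {x} = m(x)`. -/
def measure : Measure V :=
  Measure.sum fun x => ENNReal.ofReal (G.m x) • Measure.dirac x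

variable (G) in
/-- The real Hilbert space `ℓ²(V, m)`, with `⟪f, g⟫ = ∑_x f(x) g(x) m(x)`. -/
abbrev ell2 : Type _ := Lp ℝ 2 G.measure

variable [DiscreteMeasurableSpace V]

theorem measure_singleton (x : V) : G.measure {x} = ENNReal.ofReal (G.m x) := by
  classical
  rw [measure, Measure.sum_apply _ (measurableSet_singleton x), tsum_eq_single x]
  · simp
  · intro y hy
    simp [hy]

theorem eq_of_ae {f g : V → ℝ} (h : f =ᵐ[G.measure] g) : f = g := by
  funext x
  by_contra hx
  have h0 : G.measure {x} = 0 :=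
    measure_mono_null (fun y hy => by rw [Set.mem_singleton_iff.1 hy]; exact hx) (ae_iff.1 h)
  rw [measure_singleton, ENNReal.ofReal_eq_zero] at h0
  exact absurd (G.m_pos x) (not_lt.2 h0)

theorem coe_add (u v : G.ell2) : (⇑(u + v) : V → ℝ) = ⇑u + ⇑v := eq_of_ae (Lp.coeFn_add u v)

theorem coe_sub (u v : G.ell2) : (⇑(u - v) : V → ℝ) = ⇑u - ⇑v := eq_of_ae (Lp.coeFn_sub u v)

theorem coe_smul (a : ℝ) (u : G.ell2) : (⇑(a • u) : V → ℝ) = a • ⇑u :=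
  eq_of_ae (Lp.coeFn_smul a u)

theorem coe_zero : (⇑(0 : G.ell2) : V → ℝ) = 0 := eq_of_ae (Lp.coeFn_zero ℝ 2 G.measure)

variable (G) in
/-- The form domain `D(Q)`: the closure of the finitely supported functions with respect to the
form norm `⟨·,·⟩ + Q(·,·)` in `ℓ²(V, m)`. -/
def formDomain : Submodule ℝ G.ell2 where
  carrier := {u | G.energy u ≠ ∞ ∧ ∃ φ : ℕ → G.ell2, (∀ n, (Function.support (φ n)).Finite) ∧
    Tendsto φ atTop (𝓝 u) ∧ Tendsto (fun n => G.energy ⇑(u - φ n)) atTop (𝓝 0)}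
  zero_mem' := by
    have h0 : G.energy 0 = 0 := by simp [energy]
    refine ⟨by rw [coe_zero, h0]; simp, fun _ => 0, fun _ => by rw [coe_zero]; simp,
      tendsto_const_nhds, ?_⟩
    simp only [sub_zero, coe_zero, h0]
    exact tendsto_const_nhds
  add_mem' := by
    rintro u v ⟨hu, φ, hφ, hφ1, hφ2⟩ ⟨hv, ψ, hψ, hψ1, hψ2⟩
    refine ⟨?_, fun n => φ n + ψ n, fun n => ?_, hφ1.add hψ1, ?_⟩
    · rw [coe_add]
      exact ne_top_of_le_ne_top (by finiteness) (energy_add_le _ _)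
    · rw [coe_add]
      exact ((hφ n).union (hψ n)).subset (Function.support_add _ _)
    · have h2 : (2 : ℝ≥0∞) ≠ ∞ := by simp
      have hlim := (ENNReal.Tendsto.const_mul hφ2 (Or.inr h2)).add
        (ENNReal.Tendsto.const_mul hψ2 (Or.inr h2))
      simp only [mul_zero, add_zero] at hlim
      refine tendsto_of_tendsto_of_tendsto_of_le_of_le tendsto_const_nhds hlim
        (fun _ => zero_le) fun n => ?_
      have : u + v - (φ n + ψ n) = (u - φ n) + (v - ψ n) := by abel
      simp only [this]
      rw [coe_add]
      exact energy_add_le _ _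
  smul_mem' := by
    rintro a u ⟨hu, φ, hφ, hφ1, hφ2⟩
    refine ⟨?_, fun n => a • φ n, fun n => ?_, hφ1.const_smul a, ?_⟩
    · rw [coe_smul, energy_smul]
      finiteness
    · rw [coe_smul]
      exact (hφ n).subset (Function.support_const_smul_subset a _)
    · have hlim := ENNReal.Tendsto.const_mul (a := ENNReal.ofReal (a ^ 2)) hφ2
        (Or.inr ENNReal.ofReal_ne_top)
      rw [mul_zero] at hlim
      refine hlim.congr fun n => ?_
      rw [← smul_sub, coe_smul, energy_smul]

variable (G) in
/-- The graph of the operator associated with `Q`: the pairs `(u, h)` with `u ∈ D(Q)` and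
`Q(u, g) = ⟨h, g⟩` for all `g ∈ D(Q)`. -/
def laplacianGraph : Submodule ℝ (G.ell2 × G.ell2) where
  carrier := {p | p.1 ∈ G.formDomain ∧ ∀ g ∈ G.formDomain, G.form ⇑p.1 ⇑g = inner ℝ p.2 g}
  zero_mem' := by
    refine ⟨zero_mem _, fun g _ => ?_⟩
    simp only [Prod.fst_zero, Prod.snd_zero, coe_zero, inner_zero_left]
    simp [form]
  add_mem' := by
    rintro p q ⟨hp, hp'⟩ ⟨hq, hq'⟩
    refine ⟨add_mem hp hq, fun g hg => ?_⟩
    rw [Prod.fst_add, Prod.snd_add, coe_add, form_add_left hp.1 hq.1 hg.1, inner_add_left,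
      hp' g hg, hq' g hg]
  smul_mem' := by
    rintro a p ⟨hp, hp'⟩
    refine ⟨Submodule.smul_mem _ a hp, fun g hg => ?_⟩
    rw [Prod.smul_fst, Prod.smul_snd, coe_smul, form_smul_left, real_inner_smul_left, hp' g hg]

variable (G) in
/-- The Laplacian `L` of the weighted graph: the operator in `ℓ²(V, m)` associated with `Q`, i.e.
`u ∈ D(L)` and `L u = h` iff `u ∈ D(Q)` and `Q(u, g) = ⟨h, g⟩` for all `g ∈ D(Q)`. -/
def laplacian : G.ell2 →ₗ.[ℝ] G.ell2 := G.laplacianGraph.toLinearPMap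

theorem mem_formDomain_of_finite_support {u : G.ell2} (hu : (Function.support u).Finite) :
    u ∈ G.formDomain := by
  refine ⟨energy_ne_top_of_finite_support hu, fun _ => u, fun _ => hu, tendsto_const_nhds, ?_⟩
  have h0 : G.energy 0 = 0 := by simp [energy]
  simp only [sub_self, coe_zero, h0]
  exact tendsto_const_nhds

/-- The operator is well defined: its graph is the relation it was built from. -/
theorem laplacian_graph : G.laplacian.graph = G.laplacianGraph := by
  refine Submodule.toLinearPMap_graph_eq _ ?_
  rintro ⟨u, h⟩ ⟨-, hg⟩ (rfl : u = 0)
  change h = 0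
  refine Lp.ext (Eventually.of_forall fun x => ?_)
  rw [coe_zero]
  have hμ : G.measure {x} ≠ ∞ := by rw [measure_singleton]; exact ENNReal.ofReal_ne_top
  have hδ := indicatorConstLp_coeFn (p := 2) (hs := measurableSet_singleton x) (hμs := hμ)
    (c := (1 : ℝ))
  have := hg (indicatorConstLp 2 (measurableSet_singleton x) hμ 1)
    (mem_formDomain_of_finite_support (by
      rw [eq_of_ae hδ]
      exact (Set.finite_singleton x).subset Set.support_indicator_subset))
  rw [real_inner_comm, L2.inner_indicatorConstLp_one, Measure.restrict_singleton,
    integral_smul_measure, integral_dirac, measure_singleton,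
    ENNReal.toReal_ofReal (G.m_pos x).le, coe_zero] at this
  have h0 : G.form 0 ⇑(indicatorConstLp 2 (measurableSet_singleton x) hμ (1 : ℝ)) = 0 := by
    simp [form]
  rw [h0] at this
  exact (mul_eq_zero.1 this.symm).resolve_left (G.m_pos x).ne'

end WeightedGraph

/-! ### The spectrum of an unbounded operator -/

namespace UnboundedOperator

variable {H : Type*} [NormedAddCommGroup H] [NormedSpace ℝ H]

/-- The resolvent set: `T - t : D(T) → H` has an everywhere defined bounded inverse. -/
def resolventSet (T : H →ₗ.[ℝ] H) : Set ℝ :=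
  {t | ∃ R : H →L[ℝ] H,
    (∀ f : H, ∃ u : T.domain, (u : H) = R f ∧ T u - t • (u : H) = f) ∧
    ∀ u : T.domain, R (T u - t • (u : H)) = u}

/-- The (real) spectrum of `T`. -/
def spectrum (T : H →ₗ.[ℝ] H) : Set ℝ := (resolventSet T)ᶜ

/-- The eigenspace `{u ∈ D(T) | T u = t u}`. -/
def eigenspace (T : H →ₗ.[ℝ] H) (t : ℝ) : Submodule ℝ H :=
  (LinearMap.ker (T.toFun - t • T.domain.subtype)).map T.domain.subtype

/-- The discrete spectrum: isolated points of the spectrum which are eigenvalues of finite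
multiplicity. -/
def discreteSpectrum (T : H →ₗ.[ℝ] H) : Set ℝ :=
  {t ∈ spectrum T | (∃ ε > 0, ∀ s ∈ spectrum T, |s - t| < ε → s = t) ∧
    eigenspace T t ≠ ⊥ ∧ FiniteDimensional ℝ (eigenspace T t)}

end UnboundedOperator

end

noncomputable section

/-! ### Operators with compact resolvent -/

namespace UnboundedOperator

variable {H : Type*} [NormedAddCommGroup H]

section NormedSpace

variable [NormedSpace ℝ H] {T : H →ₗ.[ℝ] H} {A : H →L[ℝ] H}

/-! Weak spherical symmetry reduces `L̃ v = -v` to a recursion in the distance `r` to `x₀`; its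
solution with `v 0 = 1` is positive and strictly increasing
(`exists_radial_of_weaklySphericallySymmetric`). If `v` were unbounded, `ε e^{2t} v` would be a
barrier at infinity, and the parabolic maximum principle (`IsHeatSolution.le_zero`) would force
every bounded solution of the heat equation with zero initial value to vanish. Stochastic
incompleteness therefore makes `v` bounded. With `s = sup v`, the function `w = s - v` is positive,
tends to zero at infinity, and satisfies `L̃ w = q s + v ≥ 1` (`exists_vanishing_superharmonic`).

Such a `w` yields Hardy's inequality `∑ m φ² / w ≤ Q(φ)` for finitely supported `φ`, and with an
extra factor 2 on all of `D(Q)` (`hardy_of_mem_formDomain`). Two consequences follow. As `w` is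
bounded by some `W`, every eigenvalue of `L` is at least `1 / (2W)`. As `w` is small off finite
sets, the `ℓ²` mass there is a small multiple of the energy, so the inclusion `J : D(Q) → ℓ²(V, m)`
is a norm limit of finite rank operators, hence compact (`isCompactOperator_inclL`).

Then `(L + 1)⁻¹ = J J*` is compact and symmetric, and the Riesz theory of compact operators,
transported by `t ↦ (t + 1)⁻¹`, gives a nonempty spectrum consisting of isolated eigenvalues of
finite multiplicity. -/

theorem mem_eigenspace_iff_mem_graph {t : ℝ} {u : H} :
    u ∈ eigenspace T t ↔ (u, t • u) ∈ T.graph := by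
  simp only [eigenspace, Submodule.mem_map, LinearMap.mem_ker, LinearPMap.mem_graph_iff,
    LinearMap.sub_apply, LinearMap.smul_apply, Submodule.subtype_apply, sub_eq_zero]
  constructor
  · rintro ⟨y, hy, rfl⟩
    exact ⟨y, rfl, hy⟩
  · rintro ⟨y, rfl, hy⟩
    exact ⟨y, hy, rfl⟩

/-- `A = (T + 1)⁻¹`. -/
def IsShiftedInverse (T : H →ₗ.[ℝ] H) (A : H →L[ℝ] H) : Prop :=
  ∀ u h, (u, h) ∈ T.graph ↔ A (h + u) = u

theorem IsShiftedInverse.mem_eigenspace_iff (hA : IsShiftedInverse T A) {t : ℝ} {u : H} :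
    u ∈ eigenspace T t ↔ (t + 1) • A u = u := by
  rw [mem_eigenspace_iff_mem_graph, hA, ← map_smul, add_smul, one_smul]

theorem IsShiftedInverse.eigenspace_eq (hA : IsShiftedInverse T A) {t : ℝ} (ht : t + 1 ≠ 0) :
    eigenspace T t = Module.End.eigenspace (A : H →ₗ[ℝ] H) (t + 1)⁻¹ := by
  ext u
  rw [hA.mem_eigenspace_iff, Module.End.mem_eigenspace_iff, eq_inv_smul_iff₀ ht]
  rfl

theorem IsShiftedInverse.add_one_ne_zero (hA : IsShiftedInverse T A) {t : ℝ}
    (ht : eigenspace T t ≠ ⊥) : t + 1 ≠ 0 := by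
  rintro h
  refine ht ((Submodule.eq_bot_iff _).2 fun u hu => ?_)
  rw [hA.mem_eigenspace_iff, h, zero_smul] at hu
  exact hu.symm

/-- Formally `A (T - t) = 1 - (t + 1) A`, so if `B` inverts `1 - (t + 1) A`, then `B A` is the
resolvent of `T` at `t`. -/
theorem IsShiftedInverse.mem_resolventSet (hA : IsShiftedInverse T A) {t : ℝ} {B : H →L[ℝ] H}
    (h1 : ∀ f, B (f - (t + 1) • A f) = f) (h2 : ∀ f, B f - (t + 1) • A (B f) = f) :
    t ∈ resolventSet T := by
  refine ⟨B.comp A, fun f => ?_, fun u => ?_⟩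
  · have hg : (B (A f), f + t • B (A f)) ∈ T.graph := by
      rw [hA, add_assoc, ← one_smul ℝ (B (A f)), smul_smul, ← add_smul, mul_one, map_add,
        map_smul, ← eq_sub_iff_add_eq, one_smul]
      exact (h2 (A f)).symm
    obtain ⟨y, hy1, hy2⟩ := (LinearPMap.mem_graph_iff _).1 hg
    refine ⟨y, hy1, ?_⟩
    rw [hy2, hy1]
    simp
  · have hu := (hA _ _).1 (T.mem_graph u)
    have h3 : A (T u - t • (u : H)) = u - (t + 1) • A u := by
      rw [map_sub, map_smul, eq_sub_of_add_eq ((map_add A _ _).symm.trans hu), add_smul, one_smul,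
        sub_right_comm, sub_sub]
    rw [ContinuousLinearMap.comp_apply, h3, h1]

theorem eigenspace_eq_bot_of_mem_resolventSet {t : ℝ} (ht : t ∈ resolventSet T) :
    eigenspace T t = ⊥ := by
  obtain ⟨R, -, hR⟩ := ht
  refine (Submodule.eq_bot_iff _).2 fun u hu => ?_
  obtain ⟨y, hy1, hy2⟩ := (LinearPMap.mem_graph_iff _).1 (mem_eigenspace_iff_mem_graph.1 hu)
  have := hR y
  rw [hy2, hy1, sub_self, map_zero] at this
  exact this.symm

/-- This is the Fredholm alternative for `A` at `(t + 1)⁻¹`. -/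
theorem IsShiftedInverse.mem_spectrum_iff [CompleteSpace H] (hA : IsShiftedInverse T A)
    (hc : IsCompactOperator A) {t : ℝ} : t ∈ spectrum T ↔ eigenspace T t ≠ ⊥ := by
  refine ⟨fun ht hb => ht ?_, fun hb ht => hb (eigenspace_eq_bot_of_mem_resolventSet ht)⟩
  -- At `t = -1` the number `(t + 1)⁻¹` is meaningless, but `1 - (t + 1) A` is the identity.
  by_cases h0 : t + 1 = 0
  · exact hA.mem_resolventSet (B := ContinuousLinearMap.id ℝ H) (by simp [h0]) (by simp [h0])
  have hμ : (t + 1)⁻¹ ≠ 0 := inv_ne_zero h0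
  have hr := (hc.hasEigenvalue_or_mem_resolventSet hμ).resolve_left (by
    rw [Module.End.hasEigenvalue_iff, ← hA.eigenspace_eq h0]
    exact not_not.2 hb)
  rw [_root_.spectrum.mem_resolventSet_iff] at hr
  obtain ⟨U, hU⟩ := hr
  have hUv : ∀ f, (U : H →L[ℝ] H) f = (t + 1)⁻¹ • f - A f := fun f => by
    rw [hU]; simp [Algebra.algebraMap_eq_smul_one]
  have e1 : ∀ f, (↑U⁻¹ : H →L[ℝ] H) ((U : H →L[ℝ] H) f) = f := fun f => by
    rw [← mul_apply_eq_comp, U.inv_mul]; rfl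
  have e2 : ∀ f, (U : H →L[ℝ] H) ((↑U⁻¹ : H →L[ℝ] H) f) = f := fun f => by
    rw [← mul_apply_eq_comp, U.mul_inv]; rfl
  have e3 : ∀ f, f - (t + 1) • A f = (t + 1) • (U : H →L[ℝ] H) f := fun f => by
    rw [hUv, smul_sub, smul_inv_smul₀ h0]
  refine hA.mem_resolventSet (B := (t + 1)⁻¹ • (↑U⁻¹ : H →L[ℝ] H)) (fun f => ?_) (fun f => ?_)
  · rw [e3, map_smul, smul_apply, e1, smul_inv_smul₀ h0]
  · rw [e3, smul_apply, map_smul, e2, smul_inv_smul₀ h0]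

end NormedSpace

variable [InnerProductSpace ℝ H] {T : H →ₗ.[ℝ] H} {A : H →L[ℝ] H}

/-! ### Isolation of nonzero eigenvalues -/

theorem eventually_mem_resolventSet {X : Type*} [NormedAddCommGroup X] [NormedSpace ℝ X]
    [CompleteSpace X] {S : X →L[ℝ] X} {μ : ℝ} (h : μ ∈ _root_.resolventSet ℝ S) :
    ∀ᶠ ν in 𝓝 μ, ν ∈ _root_.resolventSet ℝ S :=
  (_root_.spectrum.isOpen_resolventSet S).mem_nhds h

theorem exists_restrict_of_isCompactOperator (hc : IsCompactOperator A) {F : Submodule ℝ H}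
    [CompleteSpace F] (hinv : ∀ x ∈ F, A x ∈ F) :
    ∃ S : F →L[ℝ] F, IsCompactOperator S ∧ ∀ x : F, (S x : H) = A x :=
  ⟨A.restrict hinv, hc.restrict' (f := (A : H →ₗ[ℝ] H)) hinv, fun _ => rfl⟩

theorem mem_resolventSet_restrict {F : Submodule ℝ H} [CompleteSpace F] {S : F →L[ℝ] F}
    (hS : IsCompactOperator S) (hSA : ∀ x : F, (S x : H) = A x) {μ : ℝ} (hμ : μ ≠ 0)
    (h0 : ∀ x ∈ F, A x = μ • x → x = 0) : μ ∈ _root_.resolventSet ℝ S := by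
  refine (hS.hasEigenvalue_or_mem_resolventSet hμ).resolve_left fun h => ?_
  obtain ⟨x, hx⟩ := h.exists_hasEigenvector
  have hx1 : S x = μ • x := hx.apply_eq_smul
  exact hx.2 (Subtype.ext (h0 x x.2 (by rw [← hSA, hx1]; rfl)))

theorem eq_zero_of_mem_resolventSet_restrict {F : Submodule ℝ H} {S : F →L[ℝ] F}
    (hSA : ∀ x : F, (S x : H) = A x) {ν : ℝ} (hν : ν ∈ _root_.resolventSet ℝ S) :
    ∀ x ∈ F, A x = ν • x → x = 0 := by
  intro x hxF hx
  obtain ⟨U, hU⟩ := _root_.spectrum.mem_resolventSet_iff.1 hν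
  have hUx : (U : F →L[ℝ] F) ⟨x, hxF⟩ = 0 := by
    apply Subtype.ext
    rw [hU]
    simp [Algebra.algebraMap_eq_smul_one, hSA, hx]
  have e1 : (↑U⁻¹ : F →L[ℝ] F) ((U : F →L[ℝ] F) ⟨x, hxF⟩) = ⟨x, hxF⟩ := by
    rw [← mul_apply_eq_comp, U.inv_mul]; rfl
  rw [hUx, map_zero] at e1
  exact (congrArg Subtype.val e1).symm

/-- Let `A` be compact, `F` a complete invariant subspace and `μ ≠ 0` without eigenvectors in `F`.
Then no `ν` near `μ` has eigenvectors in `F`. -/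
theorem eventually_eq_zero_of_apply_eq_smul (hc : IsCompactOperator A) {F : Submodule ℝ H}
    [CompleteSpace F] (hinv : ∀ x ∈ F, A x ∈ F) {μ : ℝ} (hμ : μ ≠ 0)
    (h0 : ∀ x ∈ F, A x = μ • x → x = 0) :
    ∀ᶠ ν in 𝓝 μ, ∀ x ∈ F, A x = ν • x → x = 0 := by
  obtain ⟨S, hS, hSA⟩ := exists_restrict_of_isCompactOperator hc hinv
  exact (eventually_mem_resolventSet (mem_resolventSet_restrict hS hSA hμ h0)).mono
    fun _ hν => eq_zero_of_mem_resolventSet_restrict hSA hν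

variable [CompleteSpace H]

/-- Nonzero eigenvalues of a compact symmetric operator are isolated among the eigenvalues. -/
theorem eventually_not_hasEigenvalue (hc : IsCompactOperator A)
    (hs : (A : H →ₗ[ℝ] H).IsSymmetric) {μ : ℝ} (hμ : μ ≠ 0) :
    ∀ᶠ ν in 𝓝 μ, ν ≠ μ → ¬ Module.End.HasEigenvalue (A : H →ₗ[ℝ] H) ν := by
  have hs' : ∀ x y, inner ℝ (A x) y = inner ℝ x (A y) := hs
  have hmem : ∀ x, x ∈ Module.End.eigenspace (A : H →ₗ[ℝ] H) μ ↔ A x = μ • x := fun x =>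
    Module.End.mem_eigenspace_iff
  have hcl : CompleteSpace (Module.End.eigenspace (A : H →ₗ[ℝ] H) μ)ᗮ := inferInstance
  have hort : ∀ x, x ∈ (Module.End.eigenspace (A : H →ₗ[ℝ] H) μ)ᗮ ↔
      ∀ y, A y = μ • y → inner ℝ y x = 0 := fun x => by
    simp only [Submodule.mem_orthogonal, hmem]
  generalize (Module.End.eigenspace (A : H →ₗ[ℝ] H) μ)ᗮ = F at hcl hort
  -- On the orthogonal complement `F` of the `μ`-eigenspace, `μ` is no longer an eigenvalue, so by
  -- openness of the resolvent set nearby `ν` are not either. By symmetry an eigenvector for `ν ≠ μ`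
  -- lies in `F`.
  have hinv : ∀ x ∈ F, A x ∈ F := fun x hx => by
    rw [hort] at hx ⊢
    intro y hy
    rw [← hs', hy, inner_smul_left, hx y hy, mul_zero]
  filter_upwards [eventually_eq_zero_of_apply_eq_smul hc hinv hμ fun x hxF hx =>
    inner_self_eq_zero.1 ((hort x).1 hxF x hx)] with ν hν hne he
  obtain ⟨x, hx⟩ := he.exists_hasEigenvector
  have hx1 : A x = ν • x := hx.apply_eq_smul
  refine hx.2 (hν x ((hort x).2 fun y hy => ?_) hx1)
  have h1 := hs' y x
  rw [hy, hx1, real_inner_smul_left, real_inner_smul_right] at h1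
  have : (ν - μ) * inner ℝ y x = 0 := by linarith
  exact (mul_eq_zero.1 this).resolve_left (sub_ne_zero.2 hne)

/-- The map `t ↦ (t + 1)⁻¹` sends spectral points of `T` to nonzero eigenvalues of `A` with the same
eigenspaces. It is continuous and injective, so isolation pulls back. -/
theorem IsShiftedInverse.spectrum_eq_discreteSpectrum (hA : IsShiftedInverse T A)
    (hc : IsCompactOperator A) (hs : (A : H →ₗ[ℝ] H).IsSymmetric) :
    spectrum T = discreteSpectrum T := by
  refine Set.Subset.antisymm (fun t ht => ⟨ht, ?_, ?_, ?_⟩) fun t ht => ht.1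
  · have ht0 := hA.add_one_ne_zero ((hA.mem_spectrum_iff hc).1 ht)
    have hcont : Tendsto (fun s : ℝ => (s + 1)⁻¹) (𝓝 t) (𝓝 (t + 1)⁻¹) :=
      (tendsto_id.add_const 1).inv₀ ht0
    obtain ⟨ε, hε, h⟩ := Metric.eventually_nhds_iff.1
      (hcont.eventually (eventually_not_hasEigenvalue hc hs (inv_ne_zero ht0)))
    refine ⟨ε, hε, fun s hs' hst => ?_⟩
    by_contra hne
    have hse := (hA.mem_spectrum_iff hc).1 hs'
    refine h (by rwa [Real.dist_eq]) (fun he => hne ?_) ?_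
    · simpa using inv_injective he
    · rwa [Module.End.hasEigenvalue_iff, ← hA.eigenspace_eq (hA.add_one_ne_zero hse)]
  · exact (hA.mem_spectrum_iff hc).1 ht
  · have ht0 := hA.add_one_ne_zero ((hA.mem_spectrum_iff hc).1 ht)
    rw [hA.eigenspace_eq ht0]
    exact ContinuousLinearMap.finite_dimensional_eigenspace hc _ (inv_ne_zero ht0)

theorem IsShiftedInverse.spectrum_nonempty [Nontrivial H] (hA : IsShiftedInverse T A)
    (hc : IsCompactOperator A) (hs : (A : H →ₗ[ℝ] H).IsSymmetric) : (spectrum T).Nonempty := by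
  -- If `A = 0`, every pair `(0, h)` would lie in the graph of `T`.
  have hA0 : A ≠ 0 := by
    rintro rfl
    obtain ⟨h, hh⟩ := exists_ne (0 : H)
    exact hh (T.graph_fst_eq_zero_snd ((hA 0 h).2 (by simp)) rfl)
  have := (ContinuousLinearMap.eq_zero_of_forall_hasEigenvalue_eq_zero hc hs).not.2 hA0
  push Not at this
  obtain ⟨μ, hμ, hμ0⟩ := this
  refine ⟨μ⁻¹ - 1, (hA.mem_spectrum_iff hc).2 ?_⟩
  rw [hA.eigenspace_eq (by simpa using hμ0)]
  simpa using Module.End.hasEigenvalue_iff.1 hμ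

end UnboundedOperator

namespace WeightedGraph

/-! ### Sums in `ℓ²(V, m)` -/

section Ell2

variable {V : Type*} {G : WeightedGraph V} [MeasurableSpace V] [DiscreteMeasurableSpace V]

theorem hasSum_inner (u v : G.ell2) : HasSum (fun x => G.m x * u x * v x) (inner ℝ u v) := by
  have hi : Integrable (fun x => inner ℝ (u x) (v x)) G.measure := L2.integrable_inner u v
  rw [L2.inner_def]
  convert! hasSum_integral_measure hi using 2 with x
  rw [integral_smul_measure, integral_dirac, ENNReal.toReal_ofReal (G.m_pos x).le]
  simp only [RCLike.inner_apply, conj_trivial, smul_eq_mul]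
  ring

theorem hasSum_norm_sq (u : G.ell2) : HasSum (fun x => G.m x * u x ^ 2) (‖u‖ ^ 2) := by
  rw [← real_inner_self_eq_norm_sq]
  simpa only [pow_two, mul_assoc] using hasSum_inner u u

theorem m_mul_sq_le (u : G.ell2) (x : V) : G.m x * u x ^ 2 ≤ ‖u‖ ^ 2 :=
  le_hasSum (hasSum_norm_sq u) x fun y _ => mul_nonneg (G.m_pos y).le (sq_nonneg _)

/-- The bound `m(x) u(x)² ≤ ‖u‖²` makes evaluation at a point continuous. This lets pointwise lower
semicontinuity be used along `ℓ²`-limits. -/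
theorem tendsto_coe {ι : Type*} {l : Filter ι} {φ : ι → G.ell2} {u : G.ell2}
    (h : Tendsto φ l (𝓝 u)) : Tendsto (fun n => ⇑(φ n)) l (𝓝 ⇑u) := by
  refine tendsto_pi_nhds.2 fun x => ?_
  rw [tendsto_iff_norm_sub_tendsto_zero] at h ⊢
  have h2 : Tendsto (fun n => (Real.sqrt (G.m x))⁻¹ * ‖φ n - u‖) l (𝓝 0) := by
    simpa using h.const_mul (Real.sqrt (G.m x))⁻¹
  refine squeeze_zero (fun _ => norm_nonneg _) (fun n => ?_) h2
  have hm := Real.sqrt_pos.2 (G.m_pos x)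
  rw [le_inv_mul_iff₀ hm]
  refine abs_le_of_sq_le_sq' ?_ (norm_nonneg _) |>.2
  have h3 := m_mul_sq_le (φ n - u) x
  rw [coe_sub, Pi.sub_apply] at h3
  rw [mul_pow, Real.sq_sqrt (G.m_pos x).le, Real.norm_eq_abs, sq_abs]
  exact h3

variable (G) in
/-- The indicator function of `{x}` as an element of `ℓ²(V, m)`. -/
def single (x : V) : G.ell2 :=
  indicatorConstLp 2 (measurableSet_singleton x)
    (by rw [measure_singleton]; exact ENNReal.ofReal_ne_top : G.measure {x} ≠ ∞) 1

theorem coe_single (x : V) : (⇑(G.single x) : V → ℝ) = Set.indicator {x} fun _ => 1 :=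
  eq_of_ae indicatorConstLp_coeFn

theorem inner_single (x : V) (u : G.ell2) : inner ℝ (G.single x) u = G.m x * u x := by
  refine (hasSum_inner (G.single x) u).unique ?_
  have h := hasSum_single (f := fun y => G.m y * G.single x y * u y) x fun y hy => by
    simp [coe_single, hy]
  simpa [coe_single] using h

theorem nontrivial_ell2 (x : V) : Nontrivial G.ell2 := by
  refine ⟨G.single x, 0, fun h => ?_⟩
  have := congrFun (congrArg (fun u : G.ell2 => (⇑u : V → ℝ)) h) x
  rw [coe_single, coe_zero] at this
  simp at this

end Ell2

/-! ### The form domain as a Hilbert space -/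

section Energy

variable {V : Type*} {G : WeightedGraph V}

/-- The energy is a sum of nonnegative continuous functions for pointwise convergence; this plays
the role of Fatou's lemma. -/
theorem lowerSemicontinuous_energy : LowerSemicontinuous G.energy := by
  unfold energy
  refine LowerSemicontinuous.add ?_ (lowerSemicontinuous_tsum fun x =>
    (ENNReal.continuous_ofReal.comp (by fun_prop)).lowerSemicontinuous)
  simp_rw [← ENNReal.tsum_mul_left]
  refine lowerSemicontinuous_tsum fun p => Continuous.lowerSemicontinuous ?_
  exact (ENNReal.continuous_const_mul (by simp)).comp
    (ENNReal.continuous_ofReal.comp (by fun_prop))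

theorem energy_le_of_tendsto {ι : Type*} {l : Filter ι} [l.NeBot] {f : ι → V → ℝ} {g : V → ℝ}
    (h : Tendsto f l (𝓝 g)) {C : ℝ≥0∞} (hC : ∀ᶠ n in l, G.energy (f n) ≤ C) : G.energy g ≤ C :=
  (lowerSemicontinuous_energy.isClosed_preimage C).mem_of_tendsto h hC

theorem form_comm (f g : V → ℝ) : G.form f g = G.form g f := by
  unfold form
  congr 2
  · exact tsum_congr fun p => by ring
  · exact funext fun p => by ring

theorem form_self (f : V → ℝ) (hf : G.energy f ≠ ∞) : G.form f f = (G.energy f).toReal := by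
  have h1 := summable_edges_of_energy hf
  have h2 := summable_vertices_of_energy hf
  have n1 : ∀ p : V × V, 0 ≤ G.b p.1 p.2 * (f p.1 - f p.2) ^ 2 := fun p =>
    mul_nonneg (G.b_nonneg _ _) (sq_nonneg _)
  have n2 : ∀ x, 0 ≤ G.c x * f x ^ 2 := fun p => mul_nonneg (G.c_nonneg _) (sq_nonneg _)
  rw [energy, ← ENNReal.ofReal_tsum_of_nonneg n1 h1, ← ENNReal.ofReal_tsum_of_nonneg n2 h2,
    ENNReal.toReal_add (ENNReal.mul_ne_top (by simp) ENNReal.ofReal_ne_top) ENNReal.ofReal_ne_top,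
    ENNReal.toReal_mul, ENNReal.toReal_ofReal (tsum_nonneg n1),
    ENNReal.toReal_ofReal (tsum_nonneg n2), form]
  simp only [pow_two, mul_assoc]
  norm_num

theorem form_self_nonneg (f : V → ℝ) : 0 ≤ G.form f f := by
  unfold form
  refine add_nonneg (mul_nonneg (by norm_num) (tsum_nonneg fun p => ?_)) (tsum_nonneg fun x => ?_)
  · rw [mul_assoc]
    exact mul_nonneg (G.b_nonneg _ _) (mul_self_nonneg _)
  · rw [mul_assoc]
    exact mul_nonneg (G.c_nonneg _) (mul_self_nonneg _)

end Energy

variable {V : Type*} {G : WeightedGraph V} [MeasurableSpace V] [DiscreteMeasurableSpace V]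

/-- A closure is closed: choose for each `v n` a finitely supported `φ n` within `1 / (n + 1)` in
both norm and energy. -/
theorem mem_formDomain_of_tendsto {v : ℕ → G.ell2} {u : G.ell2} (hv : ∀ n, v n ∈ G.formDomain)
    (h1 : Tendsto v atTop (𝓝 u)) (h2 : Tendsto (fun n => G.energy ⇑(u - v n)) atTop (𝓝 0)) :
    u ∈ G.formDomain := by
  constructor
  · obtain ⟨n, hn⟩ := (h2.eventually (gt_mem_nhds (zero_lt_one (α := ℝ≥0∞)))).exists
    have : u = (u - v n) + v n := by abel
    rw [this, coe_add]
    have := (hv n).1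
    have := hn.ne_top
    exact ne_top_of_le_ne_top (by finiteness) (energy_add_le _ _)
  · have hex : ∀ n : ℕ, ∃ φ : G.ell2, (Function.support φ).Finite ∧
        ‖v n - φ‖ < 1 / ((n : ℝ) + 1) ∧ G.energy ⇑(v n - φ) < ((n : ℝ≥0∞) + 1)⁻¹ := by
      intro n
      obtain ⟨-, φ, hφ, hφ1, hφ2⟩ := hv n
      have e1 : ∀ᶠ k in atTop, ‖v n - φ k‖ < 1 / ((n : ℝ) + 1) := by
        have := (Metric.tendsto_nhds.1 hφ1) (1 / ((n : ℝ) + 1)) (by positivity)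
        filter_upwards [this] with k hk
        rwa [dist_comm, dist_eq_norm] at hk
      have e2 := hφ2.eventually (gt_mem_nhds (ENNReal.inv_pos.2 (by finiteness) :
        0 < ((n : ℝ≥0∞) + 1)⁻¹))
      obtain ⟨k, hk1, hk2⟩ := (e1.and e2).exists
      exact ⟨φ k, hφ k, hk1, hk2⟩
    choose φ hφ hφ1 hφ2 using hex
    refine ⟨φ, hφ, ?_, ?_⟩
    · have h3 : Tendsto (fun n => v n - φ n) atTop (𝓝 0) :=
        squeeze_zero_norm (fun n => (hφ1 n).le) tendsto_one_div_add_atTop_nhds_zero_nat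
      simpa using h1.sub h3
    · have h3 : Tendsto (fun n : ℕ => ((n : ℝ≥0∞) + 1)⁻¹) atTop (𝓝 0) := by
        have := (tendsto_add_atTop_iff_nat 1).2 ENNReal.tendsto_inv_nat_nhds_zero
        simpa using this
      have hlim := (ENNReal.Tendsto.const_mul (a := 2) h2 (Or.inr (by simp))).add
        (ENNReal.Tendsto.const_mul (a := 2) h3 (Or.inr (by simp)))
      simp only [mul_zero, add_zero] at hlim
      refine tendsto_of_tendsto_of_tendsto_of_le_of_le tendsto_const_nhds hlim
        (fun _ => zero_le) fun n => ?_
      have : u - φ n = (u - v n) + (v n - φ n) := by abel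
      simp only [this]
      rw [coe_add]
      exact (energy_add_le _ _).trans (by gcongr; exact (hφ2 n).le)

variable (G) in
/-- The form domain `D(Q)` with the form inner product `⟨·,·⟩ + Q(·,·)`. -/
def FormSpace : Type _ := G.formDomain

namespace FormSpace

instance : AddCommGroup G.FormSpace := inferInstanceAs (AddCommGroup G.formDomain)

instance : Module ℝ G.FormSpace := inferInstanceAs (Module ℝ G.formDomain)

/-- The inclusion of `D(Q)` into `ℓ²(V, m)`. -/
def incl : G.FormSpace →ₗ[ℝ] G.ell2 := G.formDomain.subtype

theorem incl_mem (u : G.FormSpace) : incl u ∈ G.formDomain := u.2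

theorem incl_injective : Function.Injective (incl : G.FormSpace → G.ell2) := Subtype.val_injective

theorem exists_incl_eq {u : G.ell2} (hu : u ∈ G.formDomain) : ∃ v : G.FormSpace, incl v = u :=
  ⟨⟨u, hu⟩, rfl⟩

/-- The form inner product on `D(Q)`. -/
@[reducible]
def core : InnerProductSpace.Core ℝ G.FormSpace where
  inner u v := inner ℝ (incl u) (incl v) + G.form (incl u) (incl v)
  conj_inner_symm u v := by
    rw [form_comm, real_inner_comm]
    rfl
  re_inner_nonneg u := add_nonneg real_inner_self_nonneg (form_self_nonneg _)
  add_left u v w := by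
    rw [map_add, coe_add, form_add_left (incl_mem u).1 (incl_mem v).1 (incl_mem w).1,
      inner_add_left]
    ring
  smul_left u v a := by
    rw [map_smul, coe_smul, form_smul_left, inner_smul_left]
    simp only [conj_trivial]
    ring
  definite u hu := by
    have h1 : inner ℝ (incl u) (incl u) = (0 : ℝ) :=
      le_antisymm (by linarith [form_self_nonneg (G := G) (incl u)]) real_inner_self_nonneg
    exact incl_injective ((inner_self_eq_zero.1 h1).trans (map_zero incl).symm)

instance : NormedAddCommGroup G.FormSpace := core.toNormedAddCommGroup

instance : InnerProductSpace ℝ G.FormSpace := InnerProductSpace.ofCore core.toCore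

theorem inner_eq (u v : G.FormSpace) :
    inner ℝ u v = inner ℝ (incl u) (incl v) + G.form (incl u) (incl v) := rfl

theorem norm_sq_eq (u : G.FormSpace) :
    ‖u‖ ^ 2 = ‖incl u‖ ^ 2 + (G.energy (incl u)).toReal := by
  rw [← real_inner_self_eq_norm_sq, inner_eq, real_inner_self_eq_norm_sq,
    form_self _ (incl_mem u).1]

theorem norm_incl_le (u : G.FormSpace) : ‖incl u‖ ≤ ‖u‖ :=
  (abs_le_of_sq_le_sq' (by rw [norm_sq_eq]; simp) (norm_nonneg _)).2

/-- The inclusion of `D(Q)` into `ℓ²(V, m)`, as a bounded operator. -/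
def inclL : G.FormSpace →L[ℝ] G.ell2 :=
  incl.mkContinuous 1 fun u => by simpa using norm_incl_le u

theorem inclL_apply (u : G.FormSpace) : inclL u = incl u := rfl

theorem energy_incl_le (u : G.FormSpace) : G.energy (incl u) ≤ ENNReal.ofReal (‖u‖ ^ 2) := by
  rw [← ENNReal.ofReal_toReal (incl_mem u).1]
  apply ENNReal.ofReal_le_ofReal
  rw [norm_sq_eq]
  linarith [sq_nonneg ‖incl u‖]

instance : CompleteSpace G.FormSpace := by
  refine Metric.complete_of_cauchySeq_tendsto fun v hv => ?_
  obtain ⟨u, hu⟩ := cauchySeq_tendsto_of_complete (inclL.uniformContinuous.comp_cauchySeq hv)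
  have hu' : Tendsto (fun n => incl (v n)) atTop (𝓝 u) := hu
  -- The Cauchy bound on the energy of `v k - v n` passes to the limit in `k` by lower
  -- semicontinuity.
  have hE : ∀ ε > 0, ∀ᶠ n in atTop, G.energy ⇑(u - incl (v n)) ≤ ENNReal.ofReal (ε ^ 2) := by
    intro ε hε
    obtain ⟨N, hN⟩ := Metric.cauchySeq_iff.1 hv ε hε
    filter_upwards [eventually_ge_atTop N] with n hn
    refine energy_le_of_tendsto (tendsto_coe (hu'.sub_const (incl (v n)))) ?_
    filter_upwards [eventually_ge_atTop N] with k hk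
    rw [← map_sub]
    refine (energy_incl_le _).trans (ENNReal.ofReal_le_ofReal ?_)
    have := hN k hk n hn
    rw [dist_eq_norm] at this
    gcongr
  have hE0 : Tendsto (fun n => G.energy ⇑(u - incl (v n))) atTop (𝓝 0) := by
    rw [ENNReal.tendsto_nhds_zero]
    intro δ hδ
    obtain ⟨ε, hε0, hε⟩ : ∃ ε : ℝ, 0 < ε ∧ ENNReal.ofReal (ε ^ 2) ≤ δ := by
      rcases eq_or_ne δ ∞ with rfl | hδ'
      · exact ⟨1, one_pos, le_top⟩
      · refine ⟨Real.sqrt δ.toReal, Real.sqrt_pos.2 (ENNReal.toReal_pos hδ.ne' hδ'), ?_⟩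
        rw [Real.sq_sqrt ENNReal.toReal_nonneg, ENNReal.ofReal_toReal hδ']
    exact (hE ε hε0).mono fun n hn => hn.trans hε
  obtain ⟨w, rfl⟩ := exists_incl_eq (mem_formDomain_of_tendsto (fun n => incl_mem (v n)) hu' hE0)
  refine ⟨w, ?_⟩
  rw [tendsto_iff_norm_sub_tendsto_zero]
  have hsq : Tendsto (fun n => ‖v n - w‖ ^ 2) atTop (𝓝 0) := by
    have h1 : Tendsto (fun n => ‖incl (w - v n)‖ ^ 2) atTop (𝓝 0) := by
      have h2 := (tendsto_iff_norm_sub_tendsto_zero.1 hu').pow 2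
      simp only [ne_eq, OfNat.ofNat_ne_zero, not_false_eq_true, zero_pow] at h2
      simpa only [map_sub, norm_sub_rev] using h2
    have h3 := (ENNReal.tendsto_toReal (by simp : (0 : ℝ≥0∞) ≠ ∞)).comp hE0
    have h4 := h1.add h3
    simp only [ENNReal.toReal_zero, add_zero] at h4
    refine h4.congr fun n => ?_
    rw [norm_sub_rev, norm_sq_eq, Function.comp_apply, map_sub]
  simpa using hsq.sqrt

end FormSpace

/-! ### The resolvent of the Laplacian -/

open ContinuousLinearMap in
variable (G) in
/-- `(L + 1)⁻¹`, as `J J*` with the inclusion `J` of the form domain. -/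
def shiftedInverse : G.ell2 →L[ℝ] G.ell2 :=
  (FormSpace.inclL (G := G)).comp (adjoint (FormSpace.inclL (G := G)))

/-- The adjoint relation `⟨J* f, g⟩ + Q(J* f, g) = ⟨f, g⟩` for `g ∈ D(Q)` is exactly the weak form
of `(L + 1) u = f`. -/
theorem isShiftedInverse_shiftedInverse :
    UnboundedOperator.IsShiftedInverse G.laplacian G.shiftedInverse := by
  have hA : ∀ f : G.ell2, ∀ g : G.FormSpace,
      inner ℝ (G.shiftedInverse f) (FormSpace.incl g) +
        G.form (G.shiftedInverse f) (FormSpace.incl g) = inner ℝ f (FormSpace.incl g) := by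
    intro f g
    have h1 := ContinuousLinearMap.adjoint_inner_left (FormSpace.inclL (G := G)) g f
    rw [FormSpace.inner_eq] at h1
    exact h1
  intro u h
  rw [laplacian_graph]
  constructor
  · rintro ⟨hu, hg⟩
    change u ∈ G.formDomain at hu
    change ∀ g ∈ G.formDomain, G.form ⇑u ⇑g = inner ℝ h g at hg
    obtain ⟨v, rfl⟩ := FormSpace.exists_incl_eq hu
    change FormSpace.incl (ContinuousLinearMap.adjoint (FormSpace.inclL (G := G))
      (h + FormSpace.incl v)) = _
    congr 1
    refine ext_inner_right ℝ fun g => ?_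
    rw [ContinuousLinearMap.adjoint_inner_left, FormSpace.inner_eq, hg _ (FormSpace.incl_mem g),
      FormSpace.inclL_apply, inner_add_left, add_comm]
  · intro hu
    have hm : u ∈ G.formDomain := by
      rw [← hu]
      exact FormSpace.incl_mem _
    refine ⟨hm, fun g hg => ?_⟩
    obtain ⟨w, rfl⟩ := FormSpace.exists_incl_eq hg
    have := hA (h + u) w
    rw [hu, inner_add_left] at this
    change G.form ⇑u _ = inner ℝ h _
    linarith

theorem isSymmetric_shiftedInverse : (G.shiftedInverse : G.ell2 →ₗ[ℝ] G.ell2).IsSymmetric := by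
  intro u v
  change inner ℝ (FormSpace.inclL _) v = inner ℝ u (FormSpace.inclL _)
  rw [← ContinuousLinearMap.adjoint_inner_left, ← ContinuousLinearMap.adjoint_inner_right]
  rfl

end WeightedGraph

namespace WeightedGraph

/-! ### Combinatorics of spheres -/

section Spheres

variable {V : Type*} (G : WeightedGraph V)

theorem reachable (x y : V) : G.toSimpleGraph.Reachable x y := by
  induction G.connected x y with
  | refl => exact SimpleGraph.Reachable.refl x
  | tail _ h ih => exact ih.trans (SimpleGraph.Adj.reachable (G := G.toSimpleGraph) h)

theorem dist_le_succ_of_pos (x₀ : V) {x y : V} (h : 0 < G.b x y) :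
    G.dist x₀ y ≤ G.dist x₀ x + 1 := by
  have h1 := (G.reachable x₀ x).dist_triangle_left y
  rwa [SimpleGraph.dist_eq_one_iff_adj.2 (show G.toSimpleGraph.Adj x y from h)] at h1

/-- Take the vertex next to `y` on a geodesic from `y` to `x₀`. -/
theorem exists_pos_of_dist_eq_succ {x₀ y : V} {r : ℕ} (h : G.dist x₀ y = r + 1) :
    ∃ x, G.dist x₀ x = r ∧ 0 < G.b x y := by
  obtain ⟨p, hp⟩ := (G.reachable y x₀).exists_walk_length_eq_dist
  rw [SimpleGraph.dist_comm, show G.toSimpleGraph.dist x₀ y = r + 1 from h] at hp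
  cases p with
  | nil => simp at hp
  | @cons _ z _ hz q =>
    have hz' : 0 < G.b z y := by rw [G.b_symm]; exact hz
    refine ⟨z, le_antisymm ?_ ?_, hz'⟩
    · rw [dist, SimpleGraph.dist_comm]
      refine (SimpleGraph.dist_le q).trans ?_
      simpa using hp.le
    · have := G.dist_le_succ_of_pos x₀ hz'
      omega

theorem finite_ball (x₀ : V) (r : ℕ) : {x | G.dist x₀ x ≤ r}.Finite := by
  induction r with
  | zero =>
    refine (Set.finite_singleton x₀).subset fun x hx => ?_
    exact ((G.reachable x₀ x).dist_eq_zero_iff.1 (Nat.le_zero.1 hx)).symm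
  | succ r ih =>
    refine (ih.union (ih.biUnion fun x _ => G.locallyFinite x)).subset fun y hy => ?_
    rcases Nat.le_succ_iff.1 hy with h | h
    · exact Or.inl h
    · obtain ⟨x, hx, hb⟩ := G.exists_pos_of_dist_eq_succ h
      exact Or.inr (Set.mem_biUnion (show x ∈ {x | G.dist x₀ x ≤ r} from hx.le) hb)

/-- Balls are finite and `V` is not, so some vertex lies beyond distance `r`; descend from it along
a geodesic. -/
theorem exists_dist_eq [Infinite V] (x₀ : V) (r : ℕ) : ∃ x, G.dist x₀ x = r := by
  have key : ∀ n, ∀ y, G.dist x₀ y = r + n → ∃ x, G.dist x₀ x = r := by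
    intro n
    induction n with
    | zero => exact fun y hy => ⟨y, hy⟩
    | succ n ih =>
      intro y hy
      obtain ⟨x, hx, -⟩ := G.exists_pos_of_dist_eq_succ (r := r + n) hy
      exact ih x hx
  obtain ⟨y, hy⟩ := (G.finite_ball x₀ r).exists_notMem
  have hy' : r < G.dist x₀ y := not_le.1 hy
  exact key (G.dist x₀ y - r) y (by omega)

/-- The neighbours of a vertex, as a finset. -/
def neighbors (x : V) : Finset V := (G.locallyFinite x).toFinset

variable {G} in
theorem mem_neighbors {x y : V} : y ∈ G.neighbors x ↔ 0 < G.b x y := by simp [neighbors]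

variable {G} in
theorem b_eq_zero_of_notMem {x y : V} (h : y ∉ G.neighbors x) : G.b x y = 0 :=
  le_antisymm (not_lt.1 (mt mem_neighbors.2 h)) (G.b_nonneg x y)

theorem finsum_b_mul (x : V) (k : V → ℝ) :
    ∑ᶠ y, G.b x y * k y = ∑ y ∈ G.neighbors x, G.b x y * k y :=
  finsum_eq_sum_of_support_subset _ fun y hy => by
    by_contra h
    exact hy (by simp [b_eq_zero_of_notMem h])

theorem finsum_mem_b (x : V) (S : Set V) :
    ∑ᶠ y ∈ S, G.b x y = ∑ y ∈ G.neighbors x, G.b x y * S.indicator 1 y := by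
  rw [finsum_mem_def, ← finsum_b_mul]
  refine finsum_congr fun y => ?_
  by_cases h : y ∈ S <;> simp [h]

theorem formalLaplacian_eq (f : V → ℝ) (x : V) :
    G.formalLaplacian f x =
      1 / G.m x * ∑ y ∈ G.neighbors x, G.b x y * (f x - f y) + G.c x / G.m x * f x := by
  rw [formalLaplacian, finsum_b_mul]

/-- Neighbours lie in the same or an adjacent sphere, and those in the same sphere contribute
nothing. At `x₀` the truncated `0 - 1 = 0` makes the inner term vanish. -/
theorem formalLaplacian_radial (x₀ : V) (g : ℕ → ℝ) (x : V) :
    G.formalLaplacian (fun y => g (G.dist x₀ y)) x =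
      G.outerCurvature x₀ x * (g (G.dist x₀ x) - g (G.dist x₀ x + 1)) +
      G.innerCurvature x₀ x * (g (G.dist x₀ x) - g (G.dist x₀ x - 1)) +
      G.normalizedPotential x * g (G.dist x₀ x) := by
  rw [formalLaplacian_eq, outerCurvature, innerCurvature, normalizedPotential, finsum_mem_b,
    finsum_mem_b, mul_assoc, mul_assoc, ← mul_add, Finset.sum_mul, Finset.sum_mul,
    ← Finset.sum_add_distrib]
  congr 2
  refine Finset.sum_congr rfl fun y hy => ?_
  have hb := mem_neighbors.1 hy
  have h1 := G.dist_le_succ_of_pos x₀ hb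
  have h2 := G.dist_le_succ_of_pos x₀ (G.b_symm x y ▸ hb : 0 < G.b y x)
  have hcases : G.dist x₀ y = G.dist x₀ x + 1 ∨ G.dist x₀ y + 1 = G.dist x₀ x ∨
      G.dist x₀ y = G.dist x₀ x := by omega
  rcases hcases with h | h | h
  · have h' : ¬ G.dist x₀ x + 1 + 1 = G.dist x₀ x := by omega
    simp [Set.indicator, h, h']
  · have h' : ¬ G.dist x₀ y = G.dist x₀ x + 1 := by omega
    have h3 : G.dist x₀ x - 1 = G.dist x₀ y := by omega
    simp [Set.indicator, h, h', h3]
  · simp [Set.indicator, h]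

theorem curvature_sum_nonneg (x : V) (S : Set V) : 0 ≤ 1 / G.m x * ∑ᶠ y ∈ S, G.b x y := by
  refine mul_nonneg (by have := G.m_pos x; positivity) ?_
  rw [finsum_mem_b]
  exact Finset.sum_nonneg fun y _ => mul_nonneg (G.b_nonneg _ _)
    (Set.indicator_nonneg (fun _ _ => zero_le_one) _)

theorem outerCurvature_pos {x₀ x y : V} (hy : G.dist x₀ y = G.dist x₀ x + 1)
    (hb : 0 < G.b x y) : 0 < G.outerCurvature x₀ x := by
  refine mul_pos (by have := G.m_pos x; positivity) ?_
  rw [finsum_mem_b]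
  refine Finset.sum_pos' (fun y _ => mul_nonneg (G.b_nonneg _ _)
    (Set.indicator_nonneg (fun _ _ => zero_le_one) _)) ⟨y, mem_neighbors.2 hb, ?_⟩
  simpa [Set.indicator, hy] using hb

end Spheres

/-! ### The radial solution of `L̃ v = -v` -/

/-- The pair `(v r, v (r + 1) - v r)` for the solution of
`k₊ (v (r + 1) - v r) = k₋ (v r - v (r - 1)) + (q + 1) v`, `v 0 = 1`. -/
def radialPair (kp kn q : ℕ → ℝ) : ℕ → ℝ × ℝ
  | 0 => (1, (q 0 + 1) / kp 0)
  | r + 1 => ((radialPair kp kn q r).1 + (radialPair kp kn q r).2,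
      (kn (r + 1) * (radialPair kp kn q r).2 + (q (r + 1) + 1) *
        ((radialPair kp kn q r).1 + (radialPair kp kn q r).2)) / kp (r + 1))

/-- Positivity of `v r` and of the increment `v (r + 1) - v r` propagate together, since the right
side of the recursion stays positive. -/
theorem exists_radial_solution {kp kn q : ℕ → ℝ} (hkp : ∀ r, 0 < kp r) (hkn : ∀ r, 0 ≤ kn r)
    (hq : ∀ r, 0 ≤ q r) : ∃ v : ℕ → ℝ, (∀ r, 1 ≤ v r) ∧ StrictMono v ∧
      ∀ r, kp r * (v r - v (r + 1)) + kn r * (v r - v (r - 1)) + q r * v r = -v r := by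
  have hP : ∀ r, 1 ≤ (radialPair kp kn q r).1 ∧ 0 < (radialPair kp kn q r).2 := by
    intro r
    induction r with
    | zero =>
      exact ⟨le_rfl, div_pos (by linarith [hq 0]) (hkp 0)⟩
    | succ r ih =>
      have h1 : 1 ≤ (radialPair kp kn q r).1 + (radialPair kp kn q r).2 := by
        linarith [ih.1, ih.2]
      refine ⟨h1, div_pos (add_pos_of_nonneg_of_pos (mul_nonneg (hkn _) ih.2.le) ?_) (hkp _)⟩
      exact mul_pos (by linarith [hq (r + 1)]) (by linarith)
  refine ⟨fun r => (radialPair kp kn q r).1, fun r => (hP r).1,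
    strictMono_nat_of_lt_succ fun r => ?_, fun r => ?_⟩
  · simp only [radialPair]
    linarith [(hP r).2]
  · have := (hkp r).ne'
    cases r with
    | zero =>
      change kp 0 * (1 - (1 + (q 0 + 1) / kp 0)) + kn 0 * (1 - 1) + q 0 * 1 = -1
      field_simp
      ring
    | succ r =>
      simp only [radialPair, Nat.add_sub_cancel]
      field_simp
      ring

variable {V : Type*} {G : WeightedGraph V}

theorem exists_radial_of_weaklySphericallySymmetric [Infinite V]
    (h : G.WeaklySphericallySymmetric) :
    ∃ x₀, ∃ v : ℕ → ℝ, (∀ r, 1 ≤ v r) ∧ StrictMono v ∧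
      ∀ x, G.formalLaplacian (fun y => v (G.dist x₀ y)) x = -v (G.dist x₀ x) := by
  obtain ⟨x₀, ⟨kp, hkp⟩, ⟨kn, hkn⟩, ⟨q, hq⟩⟩ := h
  -- The recursion divides by `κ₊`. Since every sphere is nonempty, each has a vertex with a
  -- neighbour in the next one, and symmetry extends positivity to the whole sphere.
  have h1 : ∀ r, 0 < kp r := fun r => by
    obtain ⟨y, hy⟩ := G.exists_dist_eq x₀ (r + 1)
    obtain ⟨x, hx, hb⟩ := G.exists_pos_of_dist_eq_succ hy
    have := G.outerCurvature_pos (hx ▸ hy) hb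
    rwa [hkp, hx] at this
  have h2 : ∀ r, 0 ≤ kn r := fun r => by
    obtain ⟨x, hx⟩ := G.exists_dist_eq x₀ r
    have := G.curvature_sum_nonneg x {y | G.dist x₀ y + 1 = G.dist x₀ x}
    rw [← innerCurvature, hkn, hx] at this
    exact this
  have h3 : ∀ r, 0 ≤ q r := fun r => by
    obtain ⟨x, rfl⟩ := G.exists_dist_eq x₀ r
    rw [← hq]
    exact div_nonneg (G.c_nonneg x) (G.m_pos x).le
  obtain ⟨v, hv1, hv2, hv3⟩ := exists_radial_solution h1 h2 h3
  refine ⟨x₀, v, hv1, hv2, fun x => ?_⟩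
  rw [formalLaplacian_radial, hkp, hkn, hq, hv3]

/-! ### The parabolic maximum principle -/

/-- Only left difference quotients are used, so a maximum at the final time is allowed. -/
theorem deriv_nonneg_of_forall_le {f : ℝ → ℝ} {D t : ℝ} (hf : HasDerivAt f D t) (ht : 0 < t)
    (hmax : ∀ s ∈ Set.Icc 0 t, f s ≤ f t) : 0 ≤ D := by
  have h1 := hasDerivWithinAt_iff_tendsto_slope.1 (hf.hasDerivWithinAt (s := Set.Iio t))
  rw [Set.sdiff_singleton_eq_self (by simp)] at h1
  refine ge_of_tendsto h1 ?_
  filter_upwards [Ioo_mem_nhdsLT ht] with s hs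
  rw [slope_def_field]
  exact div_nonneg_of_nonpos (by linarith [hmax s ⟨hs.1.le, hs.2.le⟩]) (by linarith [hs.2])

theorem formalLaplacian_sub_const_mul (f g : V → ℝ) (a : ℝ) (x : V) :
    G.formalLaplacian (fun y => f y - a * g y) x =
      G.formalLaplacian f x - a * G.formalLaplacian g x := by
  have : ∀ y, G.b x y * (f x - a * g x - (f y - a * g y)) =
      G.b x y * (f x - f y) - a * (G.b x y * (g x - g y)) := fun y => by ring
  simp only [formalLaplacian_eq, this, Finset.sum_sub_distrib, ← Finset.mul_sum]
  ring

theorem formalLaplacian_nonneg_of_forall_le {f : V → ℝ} {x : V} (h0 : 0 ≤ f x)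
    (hx : ∀ y, f y ≤ f x) : 0 ≤ G.formalLaplacian f x := by
  have := G.m_pos x
  have := G.c_nonneg x
  rw [formalLaplacian_eq]
  refine add_nonneg (mul_nonneg (by positivity) (Finset.sum_nonneg fun y _ => ?_)) (by positivity)
  exact mul_nonneg (G.b_nonneg _ _) (sub_nonneg.2 (hx y))

/-- If `L̃ v = -v` has a positive solution tending to infinity, then bounded solutions of the heat
equation with zero initial condition are nonpositive. -/
theorem IsHeatSolution.le_zero {u : V → ℝ → ℝ} (hu : G.IsHeatSolution (fun _ => 0) u) {C : ℝ}
    (hC : ∀ x t, 0 ≤ t → |u x t| ≤ C) {v : V → ℝ} (hv0 : ∀ x, 0 < v x)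
    (hv : ∀ x, G.formalLaplacian v x = -v x) (hfin : ∀ K, {x | v x ≤ K}.Finite)
    (x : V) {T : ℝ} (hT : 0 ≤ T) : u x T ≤ 0 := by
  suffices H : ∀ ε > 0, u x T ≤ ε * Real.exp (2 * T) * v x by
    refine le_of_forall_gt_imp_ge_of_dense fun δ hδ => ?_
    have hp : 0 < Real.exp (2 * T) * v x := mul_pos (Real.exp_pos _) (hv0 x)
    have := H (δ / (Real.exp (2 * T) * v x)) (div_pos hδ hp)
    rwa [mul_assoc, div_mul_cancel₀ _ hp.ne'] at this
  intro ε hε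
  by_contra hcon
  push Not at hcon
  -- The exponent 2 beats the eigenvalue `-1`: `(d/dt + L̃)(e^{2t} v) = e^{2t} v > 0`, a strict
  -- supersolution.
  let z : V → ℝ → ℝ := fun y t => u y t - ε * Real.exp (2 * t) * v y
  have hzx : 0 < z x T := sub_pos.2 hcon
  have hzc : ∀ y, ContinuousOn (z y) (Set.Icc 0 T) := fun y =>
    ((hu.continuousOn y).mono Set.Icc_subset_Ici_self).sub (by fun_prop)
  have hmaxt : ∀ y, ∃ t ∈ Set.Icc 0 T, ∀ s ∈ Set.Icc 0 T, z y s ≤ z y t := fun y =>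
    isCompact_Icc.exists_isMaxOn ⟨0, le_rfl, hT⟩ (hzc y)
  choose τ hτ hτmax using hmaxt
  -- Where `ε v > C` the barrier dominates the bound on `u`, so a positive maximum of `z` is
  -- attained over a finite set of vertices.
  have hout : ∀ y, C / ε < v y → ∀ t ∈ Set.Icc 0 T, z y t ≤ 0 := by
    intro y hy t ht
    have h1 := (abs_le.1 (hC y t ht.1)).2
    have h2 : C < ε * v y := by rwa [div_lt_iff₀' hε] at hy
    have h3 : 1 ≤ Real.exp (2 * t) := Real.one_le_exp (by linarith [ht.1])
    have h4 : ε * v y ≤ ε * Real.exp (2 * t) * v y := by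
      nlinarith [mul_pos hε (hv0 y)]
    simp only [z]
    linarith
  have hxF : x ∈ (hfin (C / ε)).toFinset := by
    rw [Set.Finite.mem_toFinset]
    by_contra h
    exact absurd (hout x (not_le.1 h) T ⟨hT, le_rfl⟩) (not_le.2 hzx)
  obtain ⟨p, -, hpmax⟩ := (hfin (C / ε)).toFinset.exists_max_image (fun y => z y (τ y)) ⟨x, hxF⟩
  have hpos : 0 < z p (τ p) :=
    (hzx.trans_le (hτmax x T ⟨hT, le_rfl⟩)).trans_le (hpmax x hxF)
  have hmax : ∀ y, ∀ s ∈ Set.Icc 0 T, z y s ≤ z p (τ p) := by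
    intro y s hs
    by_cases hy : v y ≤ C / ε
    · exact (hτmax y s hs).trans (hpmax y (by rwa [Set.Finite.mem_toFinset]))
    · exact (hout y (not_le.1 hy) s hs).trans hpos.le
  obtain ⟨hτ0, hτT⟩ := hτ p
  generalize τ p = t at *
  have ht : 0 < t := by
    rcases hτ0.eq_or_lt with rfl | h
    · simp only [z, hu.initial] at hpos
      have : 0 < ε * Real.exp (2 * 0) * v p := by have := hv0 p; positivity
      linarith
    · exact h
  have hd : HasDerivAt (z p) (-G.formalLaplacian (fun y => u y t) p -
      ε * (Real.exp (2 * t) * 2) * v p) t := by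
    refine (hu.hasDerivAt p t ht).sub ?_
    have h1 : HasDerivAt (fun t : ℝ => 2 * t) 2 t := by
      simpa using (hasDerivAt_id t).const_mul (2 : ℝ)
    exact ((h1.exp).const_mul ε).mul_const (v p)
  -- At the maximum both `dz/dt` and `L̃ z` are nonnegative, whereas their sum is `-ε e^{2t} v < 0`.
  have hD := deriv_nonneg_of_forall_le hd ht fun s hs => hmax p s ⟨hs.1, hs.2.trans hτT⟩
  have hL := formalLaplacian_nonneg_of_forall_le (G := G) (f := fun y => z y t) (x := p) hpos.le
    fun y => hmax y t ⟨ht.le, hτT⟩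
  rw [formalLaplacian_sub_const_mul (fun y => u y t) v, hv] at hL
  have : 0 < ε * Real.exp (2 * t) * v p := by have := hv0 p; positivity
  linarith

theorem IsHeatSolution.neg {u : V → ℝ → ℝ} (hu : G.IsHeatSolution (fun _ => 0) u) :
    G.IsHeatSolution (fun _ => 0) fun x t => -u x t where
  continuousOn x := (hu.continuousOn x).neg
  hasDerivAt x t ht := by
    convert! (hu.hasDerivAt x t ht).neg using 1
    have := formalLaplacian_sub_const_mul (G := G) (fun _ => 0) (fun y => u y t) 1 x
    simp only [zero_sub, one_mul] at this
    rw [this]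
    simp [formalLaplacian]
  initial x := by simp [hu.initial]

/-! ### From incompleteness to a vanishing supersolution -/

/-- Otherwise the maximum principle applies to both `u` and `-u`, so `u = 0`. -/
theorem StochasticallyIncompleteAtInfinity.exists_infinite_sublevel
    (h : G.StochasticallyIncompleteAtInfinity) {v : V → ℝ} (hv0 : ∀ x, 0 < v x)
    (hv : ∀ x, G.formalLaplacian v x = -v x) : ∃ K, {x | v x ≤ K}.Infinite := by
  by_contra! hfin
  replace hfin : ∀ K, {x | v x ≤ K}.Finite := fun K => by simpa using hfin K
  obtain ⟨u, hu, ⟨C, hC⟩, x, t, ht, hne⟩ := h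
  have h1 := hu.le_zero hC hv0 hv hfin x ht
  have h2 := hu.neg.le_zero (C := C) (by simpa using hC) hv0 hv hfin x ht
  exact hne (le_antisymm h1 (by linarith))

/-- A weakly spherically symmetric, stochastically incomplete graph carries a positive function
vanishing at infinity with `L̃ w ≥ 1`. -/
theorem exists_vanishing_superharmonic [Infinite V] (hsymm : G.WeaklySphericallySymmetric)
    (hinc : G.StochasticallyIncompleteAtInfinity) :
    ∃ w : V → ℝ, (∀ x, 0 < w x) ∧ (∀ x, 1 ≤ G.formalLaplacian w x) ∧
      ∀ ε > 0, {x | ε ≤ w x}.Finite := by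
  obtain ⟨x₀, v, hv1, hv2, hv3⟩ := exists_radial_of_weaklySphericallySymmetric hsymm
  obtain ⟨K, hK⟩ := hinc.exists_infinite_sublevel
    (fun x => zero_lt_one.trans_le (hv1 (G.dist x₀ x))) hv3
  -- An infinite sublevel set leaves every finite ball, so monotonicity bounds all of `v` by `K`.
  have hbdd : BddAbove (Set.range v) := by
    refine ⟨K, ?_⟩
    rintro _ ⟨r, rfl⟩
    obtain ⟨y, hy, hyr⟩ := (hK.sdiff (G.finite_ball x₀ r)).nonempty
    exact (hv2.monotone (not_le.1 hyr).le).trans hy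
  have hlim := tendsto_atTop_ciSup hv2.monotone hbdd
  set s := ⨆ r, v r
  have hlt : ∀ r, v r < s := fun r => (hv2 (Nat.lt_succ_self r)).trans_le (le_ciSup hbdd (r + 1))
  refine ⟨fun x => s - v (G.dist x₀ x), fun x => sub_pos.2 (hlt _), fun x => ?_, fun ε hε => ?_⟩
  · have := formalLaplacian_sub_const_mul (G := G) (fun _ => s) (fun y => v (G.dist x₀ y)) 1 x
    simp only [one_mul] at this
    rw [this, hv3, formalLaplacian_eq]
    have h1 : 0 ≤ G.c x / G.m x * s := mul_nonneg (div_nonneg (G.c_nonneg x) (G.m_pos x).le)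
      (by linarith [hv1 0, hlt 0])
    simp only [sub_self, mul_zero, Finset.sum_const_zero]
    linarith [hv1 (G.dist x₀ x)]
  · obtain ⟨r, hr⟩ := (hlim.eventually (lt_mem_nhds (sub_lt_self s hε))).exists
    refine (G.finite_ball x₀ r).subset fun x hx => ?_
    by_contra h
    have h2 := hv2.monotone (not_le.1 h).le
    have hx' : ε ≤ s - v (G.dist x₀ x) := hx
    linarith

end WeightedGraph

namespace WeightedGraph

/-! ### Hardy's inequality -/

section Hardy

variable {V : Type*} {G : WeightedGraph V}

/-- A Picone identity: the difference of the two sides is `(a t - b s)² / (s t)`. -/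
theorem sq_sub_ge_of_pos {a b s t : ℝ} (hs : 0 < s) (ht : 0 < t) :
    a ^ 2 / s * (s - t) + b ^ 2 / t * (t - s) ≤ (a - b) ^ 2 := by
  have h : (a - b) ^ 2 - (a ^ 2 / s * (s - t) + b ^ 2 / t * (t - s)) =
      (a * t - b * s) ^ 2 / (s * t) := by
    field_simp
    ring
  have : 0 ≤ (a * t - b * s) ^ 2 / (s * t) := by positivity
  linarith

/-- The ground state transform bound `∑ m φ² / w ≤ Q(φ, φ)` for a positive `w` with `L̃ w ≥ 1`. -/
theorem hardy_of_finite_support {w : V → ℝ} (hw : ∀ x, 0 < w x)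
    (hL : ∀ x, 1 ≤ G.formalLaplacian w x) {φ : V → ℝ} (hφ : (Function.support φ).Finite) :
    ∑' x, ENNReal.ofReal (G.m x * φ x ^ 2 / w x) ≤ G.energy φ := by
  classical
  set s := hφ.toFinset with hs
  have hs0 : ∀ x ∉ s, φ x = 0 := fun x hx => by simpa [hs] using hx
  -- Adding the neighbours of the support makes the sum over `t` the full Laplacian sum at each
  -- point of `s`; at the other points `φ` vanishes.
  set t := s ∪ s.biUnion G.neighbors with ht
  have hs0t : ∀ x ∉ t, φ x = 0 := fun x hx => hs0 x fun h => hx (Finset.mem_union_left _ h)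
  have hrow : ∀ x ∈ t, G.m x * φ x ^ 2 / w x - G.c x * φ x ^ 2 ≤
      ∑ y ∈ t, G.b x y * (φ x ^ 2 / w x * (w x - w y)) := by
    intro x _
    by_cases hx : x ∈ s
    · have hN : ∑ y ∈ t, G.b x y * (φ x ^ 2 / w x * (w x - w y)) =
          φ x ^ 2 / w x * ∑ y ∈ G.neighbors x, G.b x y * (w x - w y) := by
        rw [Finset.mul_sum, ← Finset.sum_subset (s₁ := G.neighbors x)]
        · exact Finset.sum_congr rfl fun y _ => by ring
        · exact fun y hy => Finset.mem_union_right _ (Finset.mem_biUnion.2 ⟨x, hx, hy⟩)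
        · intro y _ hy
          rw [b_eq_zero_of_notMem hy, zero_mul]
      have h1 := hL x
      rw [formalLaplacian_eq] at h1
      have hm := G.m_pos x
      have hwx := hw x
      have h2 : G.m x - G.c x * w x ≤ ∑ y ∈ G.neighbors x, G.b x y * (w x - w y) := by
        have h3 := mul_le_mul_of_nonneg_left h1 hm.le
        rw [mul_add, ← mul_assoc, mul_one_div_cancel hm.ne', ← mul_assoc,
          mul_div_cancel₀ _ hm.ne'] at h3
        linarith
      rw [hN]
      refine le_trans (le_of_eq ?_) (mul_le_mul_of_nonneg_left h2 (by positivity))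
      field_simp
    · simp [hs0 x hx]
  have hreal : ∑ x ∈ t, G.m x * φ x ^ 2 / w x ≤
      2⁻¹ * ∑ p ∈ t ×ˢ t, G.b p.1 p.2 * (φ p.1 - φ p.2) ^ 2 + ∑ x ∈ t, G.c x * φ x ^ 2 := by
    have h1 := Finset.sum_le_sum hrow
    rw [Finset.sum_sub_distrib] at h1
    -- Swapping `x` and `y` symmetrizes the double sum so that the Picone inequality applies edge by
    -- edge.
    have h2 : ∑ x ∈ t, ∑ y ∈ t, G.b x y * (φ y ^ 2 / w y * (w y - w x)) =
        ∑ x ∈ t, ∑ y ∈ t, G.b x y * (φ x ^ 2 / w x * (w x - w y)) := by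
      rw [Finset.sum_comm]
      exact Finset.sum_congr rfl fun x _ => Finset.sum_congr rfl fun y _ => by rw [G.b_symm]
    have h3 : ∑ x ∈ t, ∑ y ∈ t, G.b x y * (φ x ^ 2 / w x * (w x - w y)) +
        ∑ x ∈ t, ∑ y ∈ t, G.b x y * (φ y ^ 2 / w y * (w y - w x)) ≤
        ∑ p ∈ t ×ˢ t, G.b p.1 p.2 * (φ p.1 - φ p.2) ^ 2 := by
      rw [Finset.sum_product, ← Finset.sum_add_distrib]
      refine Finset.sum_le_sum fun x _ => ?_
      rw [← Finset.sum_add_distrib]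
      refine Finset.sum_le_sum fun y _ => ?_
      rw [← mul_add]
      exact mul_le_mul_of_nonneg_left (sq_sub_ge_of_pos (hw x) (hw y)) (G.b_nonneg _ _)
    linarith
  have n0 : ∀ x, 0 ≤ G.m x * φ x ^ 2 / w x := fun x => by
    have := G.m_pos x; have := hw x; positivity
  have n1 : ∀ p : V × V, 0 ≤ G.b p.1 p.2 * (φ p.1 - φ p.2) ^ 2 := fun p =>
    mul_nonneg (G.b_nonneg _ _) (sq_nonneg _)
  have n2 : ∀ x, 0 ≤ G.c x * φ x ^ 2 := fun x => mul_nonneg (G.c_nonneg _) (sq_nonneg _)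
  calc ∑' x, ENNReal.ofReal (G.m x * φ x ^ 2 / w x)
      = ∑ x ∈ t, ENNReal.ofReal (G.m x * φ x ^ 2 / w x) :=
        tsum_eq_sum fun x hx => by simp [hs0t x hx]
    _ = ENNReal.ofReal (∑ x ∈ t, G.m x * φ x ^ 2 / w x) :=
        (ENNReal.ofReal_sum_of_nonneg fun x _ => n0 x).symm
    _ ≤ _ := ENNReal.ofReal_le_ofReal hreal
    _ = 2⁻¹ * ∑ p ∈ t ×ˢ t, ENNReal.ofReal (G.b p.1 p.2 * (φ p.1 - φ p.2) ^ 2) +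
          ∑ x ∈ t, ENNReal.ofReal (G.c x * φ x ^ 2) := by
        rw [ENNReal.ofReal_add (mul_nonneg (by norm_num) (Finset.sum_nonneg fun p _ => n1 p))
          (Finset.sum_nonneg fun x _ => n2 x), ENNReal.ofReal_mul (by norm_num),
          ENNReal.ofReal_sum_of_nonneg fun p _ => n1 p,
          ENNReal.ofReal_sum_of_nonneg fun x _ => n2 x, ENNReal.ofReal_inv_of_pos (by norm_num),
          ENNReal.ofReal_ofNat]
    _ ≤ G.energy φ := by
        unfold energy
        gcongr
        · exact ENNReal.sum_le_tsum _
        · exact ENNReal.sum_le_tsum _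

end Hardy

variable {V : Type*} {G : WeightedGraph V} [MeasurableSpace V] [DiscreteMeasurableSpace V]

/-- The left side is lower semicontinuous, so the inequality passes to limits. The factor 2 comes
from the crude bound `energy_add_le` and is harmless. -/
theorem hardy_of_mem_formDomain {w : V → ℝ} (hw : ∀ x, 0 < w x)
    (hL : ∀ x, 1 ≤ G.formalLaplacian w x) {u : G.ell2} (hu : u ∈ G.formDomain) :
    ∑' x, ENNReal.ofReal (G.m x * u x ^ 2 / w x) ≤ 2 * G.energy u := by
  have hlsc : LowerSemicontinuous fun f : V → ℝ =>
      ∑' x, ENNReal.ofReal (G.m x * f x ^ 2 / w x) := by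
    refine lowerSemicontinuous_tsum fun x => ?_
    have : Continuous fun f : V → ℝ => G.m x * f x ^ 2 / w x :=
      (Continuous.mul continuous_const ((continuous_apply x).pow 2)).div_const _
    exact (ENNReal.continuous_ofReal.comp this).lowerSemicontinuous
  obtain ⟨-, φ, hφ, hφ1, hφ2⟩ := hu
  have hlim : Tendsto (fun n => 2 * G.energy u + 2 * G.energy ⇑(u - φ n)) atTop
      (𝓝 (2 * G.energy u)) := by
    simpa using tendsto_const_nhds (x := 2 * G.energy ⇑u) |>.add
      (ENNReal.Tendsto.const_mul (a := 2) hφ2 (Or.inr (by simp)))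
  refine le_of_forall_gt_imp_ge_of_dense fun C hC => ?_
  refine (hlsc.isClosed_preimage C).mem_of_tendsto (tendsto_coe hφ1) ?_
  filter_upwards [hlim.eventually (gt_mem_nhds hC)] with n hn
  refine (hardy_of_finite_support hw hL (hφ n)).trans (le_trans ?_ hn.le)
  have h1 : φ n = u + (-1 : ℝ) • (u - φ n) := by
    rw [neg_one_smul]; abel
  conv_lhs => rw [h1, coe_add]
  refine (energy_add_le _ _).trans ?_
  rw [coe_smul, energy_smul]
  simp

/-- Where `v ≠ 0` one has `1 ≤ ε / w`, so Hardy's inequality for `u` controls the norm of `v`. It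
serves for the tails of `u` and, with `v = u`, for the spectral bound. -/
theorem norm_sq_le_of_vanishing {w : V → ℝ} (hw : ∀ x, 0 < w x)
    (hL : ∀ x, 1 ≤ G.formalLaplacian w x) {u v : G.ell2} (hu : u ∈ G.formDomain) {ε : ℝ}
    (hε : 0 ≤ ε) (h : ∀ x, v x = 0 ∨ v x = u x ∧ w x ≤ ε) :
    ‖v‖ ^ 2 ≤ 2 * ε * (G.energy u).toReal := by
  have hn : ∀ x, 0 ≤ G.m x * v x ^ 2 := fun x => mul_nonneg (G.m_pos x).le (sq_nonneg _)
  have h1 : ENNReal.ofReal (‖v‖ ^ 2) ≤ ENNReal.ofReal ε * (2 * G.energy u) := by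
    rw [← (hasSum_norm_sq v).tsum_eq, ENNReal.ofReal_tsum_of_nonneg hn (hasSum_norm_sq v).summable]
    refine le_trans ?_ (mul_le_mul_right (hardy_of_mem_formDomain hw hL hu) _)
    rw [← ENNReal.tsum_mul_left]
    refine ENNReal.tsum_le_tsum fun x => ?_
    rw [← ENNReal.ofReal_mul hε]
    apply ENNReal.ofReal_le_ofReal
    have hm := G.m_pos x
    have hwx := hw x
    rcases h x with h0 | ⟨h0, h1⟩
    · rw [h0]
      simp only [ne_eq, OfNat.ofNat_ne_zero, not_false_eq_true, zero_pow, mul_zero]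
      positivity
    · rw [h0, ← mul_div_assoc, le_div_iff₀ hwx, mul_comm ε]
      exact mul_le_mul_of_nonneg_left h1 (by positivity)
  have h2 : ENNReal.ofReal ε * (2 * G.energy u) ≠ ∞ := by
    have := hu.1
    finiteness
  have h3 := ENNReal.toReal_mono h2 h1
  rw [ENNReal.toReal_ofReal (sq_nonneg _), ENNReal.toReal_mul, ENNReal.toReal_mul,
    ENNReal.toReal_ofReal hε] at h3
  refine h3.trans (le_of_eq ?_)
  norm_num
  ring

/-! ### Compactness of the resolvent -/

variable (G) in
/-- The multiplication by the indicator function of a finite set, on `ℓ²(V, m)`. -/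
def restrictFinset (F : Finset V) : G.ell2 →L[ℝ] G.ell2 :=
  ∑ y ∈ F, (G.m y)⁻¹ • (innerSL ℝ (G.single y)).smulRight (G.single y)

theorem restrictFinset_apply (F : Finset V) (u : G.ell2) (x : V) :
    G.restrictFinset F u x = (F : Set V).indicator u x := by
  classical
  have h1 : G.restrictFinset F u = ∑ y ∈ F, u y • G.single y := by
    rw [restrictFinset, sum_apply]
    refine Finset.sum_congr rfl fun y _ => ?_
    simp only [smul_apply, ContinuousLinearMap.smulRight_apply, innerSL_apply_apply,
      inner_single, smul_smul]
    rw [inv_mul_cancel_left₀ (G.m_pos y).ne']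
  have h2 : G.m x * G.restrictFinset F u x = G.m x * (F : Set V).indicator u x := by
    rw [← inner_single, h1, inner_sum]
    simp only [inner_smul_right, inner_single, coe_single, Set.indicator, Set.mem_singleton_iff,
      Finset.mem_coe]
    simp only [mul_ite, mul_one, mul_zero]
    rw [Finset.sum_ite_eq]
    split_ifs
    · ring
    · rfl
  exact mul_left_cancel₀ (G.m_pos x).ne' h2

theorem isCompactOperator_restrictFinset (F : Finset V) :
    IsCompactOperator (G.restrictFinset F) := by
  refine Submodule.sum_mem (compactOperator (RingHom.id ℝ) G.ell2 G.ell2) fun y _ =>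
    Submodule.smul_mem _ _ ?_
  have h : IsCompactOperator (ContinuousLinearMap.toSpanSingleton ℝ (G.single y)) :=
    isCompactOperator_of_locallyCompactSpace_rng _
  exact h.comp_clm (innerSL ℝ (G.single y))

theorem isCompactOperator_of_norm_sub_le {X Y : Type*} [NormedAddCommGroup X] [NormedSpace ℝ X]
    [NormedAddCommGroup Y] [NormedSpace ℝ Y] [CompleteSpace Y] {T : X →L[ℝ] Y}
    {S : ℕ → X →L[ℝ] Y} {ε : ℕ → ℝ} (h : ∀ n, ‖S n - T‖ ≤ ε n) (hε : Tendsto ε atTop (𝓝 0))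
    (hS : ∀ n, IsCompactOperator (S n)) : IsCompactOperator T :=
  isCompactOperator_of_tendsto
    (tendsto_iff_norm_sub_tendsto_zero.2 (squeeze_zero (fun _ => norm_nonneg _) h hε))
    (Eventually.of_forall hS)

/-- Cutting off to the finite set `{w ≥ 1 / (n + 1)}` costs at most `√(2 / (n + 1))` in operator
norm. -/
theorem isCompactOperator_inclL {w : V → ℝ} (hw : ∀ x, 0 < w x)
    (hL : ∀ x, 1 ≤ G.formalLaplacian w x) (hfin : ∀ ε > 0, {x | ε ≤ w x}.Finite) :
    IsCompactOperator (FormSpace.inclL (G := G)) := by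
  let F : ℕ → Finset V := fun n => (hfin (1 / ((n : ℝ) + 1)) (by positivity)).toFinset
  have hbound : ∀ n, ‖(G.restrictFinset (F n)).comp FormSpace.inclL - FormSpace.inclL (G := G)‖ ≤
      Real.sqrt (2 * (1 / ((n : ℝ) + 1))) := by
    intro n
    have hp : 0 ≤ 1 / ((n : ℝ) + 1) := by positivity
    refine ContinuousLinearMap.opNorm_le_bound _ (Real.sqrt_nonneg _) fun u => ?_
    refine (abs_le_of_sq_le_sq' ?_ (by positivity)).2
    rw [mul_pow, Real.sq_sqrt (by positivity), sub_apply,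
      ContinuousLinearMap.comp_apply, FormSpace.inclL_apply, norm_sub_rev]
    refine (norm_sq_le_of_vanishing hw hL (FormSpace.incl_mem u) hp fun x => ?_).trans ?_
    · rw [coe_sub, Pi.sub_apply, restrictFinset_apply]
      by_cases hx : x ∈ F n
      · exact Or.inl (by simp [hx])
      · refine Or.inr ⟨by simp [hx], ?_⟩
        simp only [F, Set.Finite.mem_toFinset, Set.mem_ofPred_eq, not_le] at hx
        exact hx.le
    · refine mul_le_mul_of_nonneg_left ?_ (by positivity)
      rw [FormSpace.norm_sq_eq]
      linarith [sq_nonneg ‖FormSpace.incl u‖]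
  refine isCompactOperator_of_norm_sub_le hbound ?_ fun n =>
    (isCompactOperator_restrictFinset (F n)).comp_clm FormSpace.inclL
  simpa using (tendsto_one_div_add_atTop_nhds_zero_nat.const_mul (2 : ℝ)).sqrt

/-- Testing the eigenvalue equation with `u` itself gives `Q(u, u) = t ‖u‖²`, while Hardy's
inequality gives `‖u‖² ≤ 2 W Q(u, u)`. -/
theorem le_of_mem_eigenspace {w : V → ℝ} (hw : ∀ x, 0 < w x)
    (hL : ∀ x, 1 ≤ G.formalLaplacian w x) {W : ℝ} (hW : 0 < W) (hwW : ∀ x, w x ≤ W) {t : ℝ}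
    (ht : UnboundedOperator.eigenspace G.laplacian t ≠ ⊥) : (2 * W)⁻¹ ≤ t := by
  obtain ⟨u, hu, hu0⟩ := Submodule.exists_mem_ne_zero_of_ne_bot ht
  rw [UnboundedOperator.mem_eigenspace_iff_mem_graph, laplacian_graph] at hu
  obtain ⟨hud, hug⟩ := hu
  change u ∈ G.formDomain at hud
  have h1 : G.form u u = inner ℝ (t • u) u := hug u hud
  rw [form_self _ hud.1, real_inner_smul_left, real_inner_self_eq_norm_sq] at h1
  have h2 := norm_sq_le_of_vanishing hw hL (v := u) hud hW.le fun x => Or.inr ⟨rfl, hwW x⟩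
  rw [h1] at h2
  have h3 : 0 < ‖u‖ ^ 2 := by have := norm_pos_iff.2 hu0; positivity
  rw [inv_le_iff_one_le_mul₀ (by positivity)]
  refine le_of_mul_le_mul_right ?_ h3
  linarith

end WeightedGraph

end

/-! ### Positivity and discreteness of the spectrum -/

open WeightedGraph in
theorem corollaryc {V : Type*} [Countable V] [Infinite V] [MeasurableSpace V]
    [DiscreteMeasurableSpace V] (G : WeightedGraph V)
    (hsymm : G.WeaklySphericallySymmetric)
    (hinc : G.StochasticallyIncompleteAtInfinity) :
    0 < sInf (UnboundedOperator.spectrum G.laplacian) ∧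
      UnboundedOperator.spectrum G.laplacian =
        UnboundedOperator.discreteSpectrum G.laplacian := by
  obtain ⟨w, hw, hL, hfin⟩ := exists_vanishing_superharmonic hsymm hinc
  have hA := isShiftedInverse_shiftedInverse (G := G)
  have hs := isSymmetric_shiftedInverse (G := G)
  have hc : IsCompactOperator G.shiftedInverse :=
    (isCompactOperator_inclL hw hL hfin).comp_clm
      (ContinuousLinearMap.adjoint (FormSpace.inclL (G := G)))
  refine ⟨?_, hA.spectrum_eq_discreteSpectrum hc hs⟩
  -- Only finitely many vertices have `w ≥ 1`, so `w` is bounded.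
  obtain ⟨W, hW, hwW⟩ : ∃ W, 0 < W ∧ ∀ x, w x ≤ W := by
    obtain ⟨B, hB⟩ := ((hfin 1 one_pos).image w).bddAbove
    refine ⟨max B 1, by positivity, fun x => ?_⟩
    by_cases hx : 1 ≤ w x
    · exact (hB ⟨x, hx, rfl⟩).trans (le_max_left _ _)
    · exact (not_le.1 hx).le.trans (le_max_right _ _)
  obtain ⟨x⟩ : Nonempty V := inferInstance
  have := nontrivial_ell2 (G := G) x
  -- Nonemptiness of the spectrum is essential here, as `sInf ∅ = 0` in `ℝ`.
  refine lt_of_lt_of_le (by positivity : 0 < (2 * W)⁻¹)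
    (le_csInf (hA.spectrum_nonempty hc hs) fun t ht => ?_)
  exact le_of_mem_eigenspace hw hL hW hwW ((hA.mem_spectrum_iff hc).1 ht)
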